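/- A (left) brace is a set $B$ with an abelian group structure $(B,+)$ and a group structure $(B,\cdot)$ such that $a\cdot(b+c)+a=a\cdot b+a\cdot c$ for all $a,b,c\in B$; braces are counted up to bijections preserving $+$ and $\cdot$. Let $p$ and $q$ be primes with $q>p$, $q\ge 5$, $p\mid q-1$, $p\nmid q+1$ and $p^2\nmid q-1$ (so $p$ is odd). Let $\lambda$ be any element of order $p$ of $(\mathbf Z/(q))^*$. For $M\in\mathrm{GL}(2,q)$ with $M^p=1$, let $(\mathbf Z/(q)\times\mathbf Z/(q))\rtimes_M(\mathbf Z/(p)\times\mathbf Z/(p))$ be the semidirect product in which $(z,t)\in \mathbf Z/(p)\times\mathbf Z/(p)$ acts on column vectors by $v\mapsto M^{z}v$, and let $(\mathbf Z/(q)\times\mathbf Z/(q))\rtimes_\lambda(\mathbf Z/(p)\times\mathbf Z/(p))$ be the one in which $(z,t)$ acts by $(x,y)\mapsto(\lambda^{t}x,\lambda^{z+t}y)$. **Theorem.** Up to isomorphism, the number of braces with additive group $\mathbf Z/(pq)\times\mathbf Z/(pq)$ is $\frac{p^2+5p}{2}+14$ if $p\equiv1\pmod 4$, and $\frac{p^2+5p}{2}+13$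 if $p\equiv 3\pmod 4$. Among them: a) exactly four have multiplicative group $\mathbf Z/(pq)\times\mathbf Z/(pq)$; b) for $M=\mathrm{diag}(1,\lambda)$, and for $M=\mathrm{diag}(\lambda,\lambda^k)$ for each $k\in\{1,\dots,p-1\}$ with $k\notin\{2,\frac{p+1}{2},p-1\}$, exactly four have multiplicative group $(\mathbf Z/(q)\times\mathbf Z/(q))\rtimes_M(\mathbf Z/(p)\times\mathbf Z/(p))$ (exponents $k$ and $k'$ with $kk'\equiv1\pmod p$ give isomorphic groups; in particular so do $2$ and $\frac{p+1}{2}$); c) if $p\ne3$ and $M=\mathrm{diag}(\lambda,\lambda^{-1})$, exactly four (if $p\equiv1\pmod4$), respectively three (if $p\equiv3\pmod 4$), have multiplicative group $(\mathbf Z/(q)\times\mathbf Z/(q))\rtimes_M(\mathbf Z/(p)\times\mathbf Z/(p))$; d) if $p\ne3$ and $M=\mathrm{diag}(\lambda,\lambda^{(p+1)/2})$, exactly eight have multiplicative group $(\mathbf Z/(q)\times\mathbf Z/(q))\rtimes_M(\mathbf Z/(p)\times\mathbf Z/(p))$; c, d$'$) if $p=3$, where $\lambda^{-1}=\lambda^{(p+1)/2}$,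 and $M=\mathrm{diag}(\lambda,\lambda^{-1})$, exactly seven have multiplicative group $(\mathbf Z/(q)\times\mathbf Z/(q))\rtimes_M(\mathbf Z/(p)\times\mathbf Z/(p))$; e) exactly $\frac{p^2+p}{2}$ have multiplicative group $(\mathbf Z/(q)\times\mathbf Z/(q))\rtimes_\lambda(\mathbf Z/(p)\times\mathbf Z/(p))$. Every brace with additive group $\mathbf Z/(pq)\times\mathbf Z/(pq)$ has one of these multiplicative groups, that is, $\mathbf Z/(pq)\times\mathbf Z/(pq)$, a group $\rtimes_M$ with $M=\mathrm{diag}(1,\lambda)$ or $M=\mathrm{diag}(\lambda,\lambda^k)$, $1\le k\le p-1$, or the group $\rtimes_\lambda$. -/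

import Mathlib

open scoped MatrixGroups

/-- A left brace: an abelian group `(B, +)` and a group `(B, *)` on the same set such that
`a * (b + c) + a = a * b + a * c`. -/
class LeftBrace (B : Type*) extends AddCommGroup B, Group B where
  brace_identity : ∀ a b c : B, a * (b + c) + a = a * b + a * c

/-- A left brace together with its underlying set. -/
structure BundledLeftBrace where
  carrier : Type
  [str : LeftBrace carrier]

namespace BundledLeftBrace

instance instLeftBraceCarrier (B : BundledLeftBrace) : LeftBrace B.carrier := B.str

/-- Isomorphism of left braces. Here `≃+*` is Mathlib's type of bijections that preserve both
`+` and `*`; no ring structure is involved. -/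
instance isoSetoid : Setoid BundledLeftBrace where
  r B C := Nonempty (B.carrier ≃+* C.carrier)
  iseqv :=
    { refl := fun B => ⟨RingEquiv.refl B.carrier⟩
      symm := fun ⟨e⟩ => ⟨e.symm⟩
      trans := fun ⟨e⟩ ⟨f⟩ => ⟨e.trans f⟩ }

/-- The additive group of `B` is isomorphic to `A`. -/
def HasAddGroup (A : Type) [AddGroup A] (B : BundledLeftBrace) : Prop :=
  Nonempty (B.carrier ≃+ A)

/-- The multiplicative group of `B` is isomorphic to `G`. -/
def HasMulGroup (G : Type) [Group G] (B : BundledLeftBrace) : Prop :=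
  Nonempty (B.carrier ≃* G)

/-- The number of isomorphism classes of left braces with additive group `A`. -/
noncomputable def numBraces (A : Type) [AddGroup A] : ℕ :=
  Set.ncard ((fun B => (⟦B⟧ : Quotient isoSetoid)) '' {B | HasAddGroup A B})

/-- The number of isomorphism classes of left braces with additive group `A` and multiplicative
group `G`. -/
noncomputable def numBracesWithMul (A : Type) [AddGroup A] (G : Type) [Group G] : ℕ :=
  Set.ncard ((fun B => (⟦B⟧ : Quotient isoSetoid)) '' {B | HasAddGroup A B ∧ HasMulGroup G B})

end BundledLeftBrace

/-- For `g ^ p = 1`, the homomorphism `z ↦ g ^ z` from the group `ℤ/p`. -/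
def zmodPowHom {G : Type*} [Group G] (p : ℕ) [NeZero p] (g : G) (hg : g ^ p = 1) :
    Multiplicative (ZMod p) →* G where
  toFun z := g ^ z.toAdd.val
  map_one' := by simp
  map_mul' a b := by
    rw [toAdd_mul, ZMod.val_add, ← pow_add, ← pow_eq_pow_mod _ hg]

/-- The invertible diagonal matrix with diagonal entries `a`, `b`. -/
def diagGL {R : Type*} [CommRing R] (a b : Rˣ) : GL (Fin 2) R where
  val := !![(a : R), 0; 0, (b : R)]
  inv := !![((a⁻¹ : Rˣ) : R), 0; 0, ((b⁻¹ : Rˣ) : R)]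
  val_inv := by ext i j; fin_cases i <;> fin_cases j <;> simp
  inv_val := by ext i j; fin_cases i <;> fin_cases j <;> simp

theorem diagGL_mul {R : Type*} [CommRing R] (a b c d : Rˣ) :
    diagGL (a * c) (b * d) = diagGL a b * diagGL c d := by
  ext i j; fin_cases i <;> fin_cases j <;> simp [diagGL]

theorem diagGL_one {R : Type*} [CommRing R] : diagGL (1 : Rˣ) 1 = 1 := by
  ext i j; fin_cases i <;> fin_cases j <;> simp [diagGL]

theorem diagGL_pow {R : Type*} [CommRing R] (a b : Rˣ) (n : ℕ) :
    diagGL a b ^ n = diagGL (a ^ n) (b ^ n) := by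
  induction n with
  | zero => simp [diagGL_one]
  | succ n ih => rw [pow_succ, ih, pow_succ, pow_succ, diagGL_mul]

theorem diagGL_zpow_pow_eq_one {R : Type*} [CommRing R] {p : ℕ} {u : Rˣ} (hu : u ^ p = 1)
    (i j : ℤ) : diagGL (u ^ i) (u ^ j) ^ p = 1 := by
  have key : ∀ n : ℤ, (u ^ n) ^ p = 1 := fun n => by
    rw [← zpow_natCast, zpow_comm, zpow_natCast, hu, one_zpow]
  rw [diagGL_pow, key i, key j, diagGL_one]

/-- The action `v ↦ M v` of `GL(2, q)` on the group `ℤ/q × ℤ/q` of column vectors. -/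
def glAction (q : ℕ) : GL (Fin 2) (ZMod q) →* MulAut (Multiplicative (Fin 2 → ZMod q)) where
  toFun M :=
    { toFun := fun v => Multiplicative.ofAdd (M.val.mulVec v.toAdd)
      invFun := fun v => Multiplicative.ofAdd ((M⁻¹).val.mulVec v.toAdd)
      left_inv := fun v => by
        change Multiplicative.ofAdd ((M⁻¹).val.mulVec (M.val.mulVec v.toAdd)) = v
        rw [Matrix.mulVec_mulVec, Units.inv_mul, Matrix.one_mulVec, ofAdd_toAdd]
      right_inv := fun v => by
        change Multiplicative.ofAdd (M.val.mulVec ((M⁻¹).val.mulVec v.toAdd)) = v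
        rw [Matrix.mulVec_mulVec, Units.mul_inv, Matrix.one_mulVec, ofAdd_toAdd]
      map_mul' := fun v w => by rw [toAdd_mul, Matrix.mulVec_add, ofAdd_add] }
  map_one' := by ext v : 1; simp
  map_mul' M N := by
    ext v : 1
    change Multiplicative.ofAdd ((M * N).val.mulVec v.toAdd) =
      Multiplicative.ofAdd (M.val.mulVec (N.val.mulVec v.toAdd))
    rw [Matrix.mulVec_mulVec, Units.val_mul]

/-- The group `(ℤ/q × ℤ/q) ⋊_M (ℤ/p × ℤ/p)`, in which `(z, t)` acts on `ℤ/q × ℤ/q`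
by `v ↦ M ^ z v`. -/
abbrev SemidirectByMatrix (p q : ℕ) [NeZero p] (M : GL (Fin 2) (ZMod q)) (hM : M ^ p = 1) : Type :=
  Multiplicative (Fin 2 → ZMod q) ⋊[(glAction q).comp ((zmodPowHom p M hM).comp
    (AddMonoidHom.toMultiplicative (AddMonoidHom.fst (ZMod p) (ZMod p))))]
    Multiplicative (ZMod p × ZMod p)

/-- For `u ^ p = 1`, the homomorphism `(z, t) ↦ diag(u ^ t, u ^ (z + t))`. -/
def faithfulHom (p q : ℕ) [NeZero p] (u : (ZMod q)ˣ) (hu : u ^ p = 1) :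
    Multiplicative (ZMod p × ZMod p) →* GL (Fin 2) (ZMod q) where
  toFun w := diagGL (zmodPowHom p u hu (Multiplicative.ofAdd w.toAdd.2))
    (zmodPowHom p u hu (Multiplicative.ofAdd (w.toAdd.1 + w.toAdd.2)))
  map_one' := by simp [diagGL_one]
  map_mul' a b := by
    rw [← diagGL_mul, ← (zmodPowHom p u hu).map_mul, ← (zmodPowHom p u hu).map_mul, ← ofAdd_add,
      ← ofAdd_add, toAdd_mul, Prod.fst_add, Prod.snd_add, add_add_add_comm]

/-- The group `(ℤ/q × ℤ/q) ⋊_u (ℤ/p × ℤ/p)`, in which `(z, t)` acts on `ℤ/q × ℤ/q`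
by `(x, y) ↦ (u ^ t x, u ^ (z + t) y)`. -/
abbrev SemidirectFaithful (p q : ℕ) [NeZero p] (u : (ZMod q)ˣ) (hu : u ^ p = 1) : Type :=
  Multiplicative (Fin 2 → ZMod q) ⋊[(glAction q).comp (faithfulHom p q u hu)]
    Multiplicative (ZMod p × ZMod p)

/-- The group `(ℤ/q × ℤ/q) ⋊_M (ℤ/p × ℤ/p)` for `M = diag(u ^ i, u ^ j)`, where `u ^ p = 1`. -/
abbrev SemidirectByDiag (p q : ℕ) [NeZero p] (u : (ZMod q)ˣ) (hu : u ^ p = 1) (i j : ℤ) : Type :=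
  SemidirectByMatrix p q (diagGL (u ^ i) (u ^ j)) (diagGL_zpow_pow_eq_one hu i j)

/-! A brace with additive group `A` is the same as a map `λ : A → Aut A` with `λ (a + λ_a b) = λ_a
λ_b`, up to conjugation by `Aut A`. Here `A = V × W` with `V = (ℤ/q)²` and `W = (ℤ/p)²`, so
automorphisms of `A` split. A fixed-point count shows that `V` acts trivially on `W`, because `q ∤
p² - 1` (`IsGamma.action_trivial`). The brace is therefore a semidirect product: a brace on `W` acts
by brace automorphisms `ρ` on a brace on `V` (`IsGamma.exists_semidirect`).

On a plane over `ℤ/ℓ` there are only two braces, the trivial one and `λ_(x,y) (x', y') = (x' + y y',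
y')` (`IsGamma.exists_conj_shear`). For odd `ℓ`, the bijection `(x, y) ↦ (x - y²/2, y)` turns the
multiplicative group of the second into the additive group. So `ρ` becomes an action of `(ℤ/p)²` on
`(ℤ/q)²`, diagonalisable since `ℤ/q` contains the `p`-th roots of unity; it is given by two
characters `χ`, `ψ` of `(ℤ/p)²`. If the brace on `V` is non-trivial, its automorphisms have diagonal
`(d², d)`, which forces `χ = 2ψ` (`exists_diagonalisation`). Hence every brace comes from a
`BraceDatum`: two Booleans and two characters.

Two data give isomorphic braces when an automorphism of the brace on `W` matches the characters,
possibly after exchanging them if the brace on `V` is trivial (`BraceDatum.exists_gamma_equiv_iff`).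
The multiplicative group sees only the unordered pair of characters up to `GL(2, p)`. There are
three kinds of pairs.

Zero characters: the two Booleans give 4 braces. Proportional characters `χ`, `kχ` with `χ ≠ 0`: the
automorphisms of the brace on `W` have one orbit on non-zero characters if that brace is trivial and
three otherwise, so 4 braces with trivial `V`; exchanging identifies two of these exactly when `k =
-1` is a non-square. Non-trivial `V` adds 4 when `k` is `2` or `1/2`. Independent characters: `V`
must be trivial, and explicit normal forms give `p (p + 1) / 2` braces. The total is obtained by
summing over the `(p + 3) / 2` classes `{k, k⁻¹}`. -/

/-! ### Braces as gamma functions -/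

/-- A gamma function on an additive group: the map `a ↦ (b ↦ a * b - a)` of a left brace. -/
def IsGamma {A : Type*} [AddCommGroup A] (lam : A → (A ≃+ A)) : Prop :=
  ∀ a b c, lam (a + lam a b) c = lam a (lam b c)

theorem IsGamma.lam_zero {A : Type*} [AddCommGroup A] {lam : A → (A ≃+ A)} (h : IsGamma lam) :
    lam 0 = AddEquiv.refl A := by
  ext c
  have := h 0 0 c
  rw [map_zero, add_zero] at this
  exact ((lam 0).injective this).symm

/-- The left brace with gamma function `lam`. -/
@[reducible] def IsGamma.leftBrace {A : Type*} [AddCommGroup A] {lam : A → (A ≃+ A)}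
    (h : IsGamma lam) : LeftBrace A :=
  { ‹AddCommGroup A› with
    mul := fun a b => a + lam a b
    one := 0
    inv := fun a => -(lam a).symm a
    mul_assoc := fun a b c => by
      change (a + lam a b) + lam (a + lam a b) c = a + lam a (b + lam b c)
      rw [h, map_add, add_assoc]
    one_mul := fun a => by
      change 0 + lam 0 a = a
      rw [h.lam_zero, zero_add, AddEquiv.refl_apply]
    mul_one := fun a => by
      change a + lam a 0 = a
      rw [map_zero, add_zero]
    inv_mul_cancel := fun a => by
      change -(lam a).symm a + lam (-(lam a).symm a) a = 0
      have h1 : a + lam a (-(lam a).symm a) = 0 := by simp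
      have h2 := h a (-(lam a).symm a) a
      rw [h1, h.lam_zero, AddEquiv.refl_apply] at h2
      rw [← (lam a).symm_apply_eq.mpr h2, neg_add_cancel]
    brace_identity := fun a b c => by
      change a + lam a (b + c) + a = a + lam a b + (a + lam a c)
      rw [map_add]; abel }

/-- The left brace with gamma function `lam`, as a bundled brace. -/
def IsGamma.brace {A : Type} [AddCommGroup A] {lam : A → (A ≃+ A)} (h : IsGamma lam) :
    BundledLeftBrace :=
  @BundledLeftBrace.mk A h.leftBrace

theorem IsGamma.brace_equiv_iff {A A' : Type} [AddCommGroup A] [AddCommGroup A']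
    {lam : A → (A ≃+ A)} {lam' : A' → (A' ≃+ A')} (h : IsGamma lam) (h' : IsGamma lam') :
    h.brace ≈ h'.brace ↔ ∃ f : A ≃+ A', ∀ a b, f (lam a b) = lam' (f a) (f b) := by
  constructor
  · rintro ⟨e⟩
    let f : A ≃+ A' := ⟨e.toEquiv, fun a b => e.map_add' a b⟩
    refine ⟨f, fun a b => ?_⟩
    have h1 : f (a + lam a b) = f a + lam' (f a) (f b) := e.map_mul' a b
    rw [map_add] at h1
    exact add_left_cancel h1
  · rintro ⟨f, hf⟩
    refine ⟨(⟨f.toEquiv, fun (a b : A) => ?_, fun (a b : A) => f.map_add a b⟩ :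
      h.brace.carrier ≃+* h'.brace.carrier)⟩
    change f ((a : A) + lam a b) = f a + lam' (f a) (f b)
    rw [map_add, hf]

theorem IsGamma.hasMulGroup_iff {A : Type} [AddCommGroup A] {lam : A → (A ≃+ A)}
    (h : IsGamma lam) (G : Type) [Group G] :
    h.brace.HasMulGroup G ↔ ∃ f : A ≃ G, ∀ a b, f (a + lam a b) = f a * f b :=
  ⟨fun ⟨e⟩ => ⟨e.toEquiv, fun a b => e.map_mul' a b⟩,
    fun ⟨f, hf⟩ => ⟨(⟨f, hf⟩ : h.brace.carrier ≃* G)⟩⟩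

theorem IsGamma.hasAddGroup {A A' : Type} [AddCommGroup A] [AddCommGroup A'] {lam : A → (A ≃+ A)}
    (h : IsGamma lam) (e : A ≃+ A') : h.brace.HasAddGroup A' :=
  ⟨(⟨e.toEquiv, e.map_add'⟩ : h.brace.carrier ≃+ A')⟩

theorem LeftBrace.mul_add_eq {B : Type*} [LeftBrace B] (a b c : B) :
    a * (b + c) = a * b - a + a * c := by
  have := LeftBrace.brace_identity a b c
  rw [← eq_sub_iff_add_eq] at this
  rw [this]; abel

theorem LeftBrace.mul_zero_eq {B : Type*} [LeftBrace B] (a : B) : a * (0 : B) = a := by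
  have := LeftBrace.brace_identity a 0 0
  rw [add_zero] at this
  exact (add_left_cancel this).symm

/-- The gamma function of a left brace. -/
def LeftBrace.gamma {B : Type*} [LeftBrace B] (a : B) : B ≃+ B where
  toFun b := a * b - a
  invFun b := a⁻¹ * (a + b)
  left_inv b := by
    simp
  right_inv b := by
    simp
  map_add' b c := by
    rw [LeftBrace.mul_add_eq]; abel

theorem LeftBrace.gamma_apply {B : Type*} [LeftBrace B] (a b : B) :
    LeftBrace.gamma a b = a * b - a := rfl

theorem LeftBrace.isGamma {B : Type*} [LeftBrace B] : IsGamma (LeftBrace.gamma (B := B)) := by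
  intro a b c
  simp only [LeftBrace.gamma_apply, add_sub_cancel]
  rw [sub_eq_add_neg (b * c), LeftBrace.mul_add_eq, ← mul_assoc]
  have h : a * (-b) = a + a - a * b := by
    have := LeftBrace.brace_identity a b (-b)
    rw [add_neg_cancel, LeftBrace.mul_zero_eq] at this
    rw [this]; abel
  rw [h]; abel

/-- Transport of a gamma function along an additive equivalence. -/
def gammaTransport {A A' : Type*} [AddCommGroup A] [AddCommGroup A'] (e : A ≃+ A')
    (lam : A → (A ≃+ A)) : A' → (A' ≃+ A') :=
  fun a => (e.symm.trans (lam (e.symm a))).trans e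

theorem gammaTransport_apply {A A' : Type*} [AddCommGroup A] [AddCommGroup A'] (e : A ≃+ A')
    (lam : A → (A ≃+ A)) (a b : A') :
    gammaTransport e lam a b = e (lam (e.symm a) (e.symm b)) := rfl

theorem IsGamma.transport {A A' : Type*} [AddCommGroup A] [AddCommGroup A'] (e : A ≃+ A')
    {lam : A → (A ≃+ A)} (h : IsGamma lam) : IsGamma (gammaTransport e lam) := by
  intro a b c
  simp only [gammaTransport_apply, map_add, AddEquiv.symm_apply_apply]
  exact congrArg e (h _ _ _)

theorem BundledLeftBrace.exists_gamma {A : Type} [AddCommGroup A] (B : BundledLeftBrace)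
    (hB : B.HasAddGroup A) :
    ∃ (lam : A → (A ≃+ A)) (h : IsGamma lam), B ≈ h.brace := by
  obtain ⟨e⟩ := hB
  refine ⟨gammaTransport e LeftBrace.gamma, LeftBrace.isGamma.transport e,
    ⟨(⟨e.toEquiv, fun a b => ?_, fun a b => e.map_add a b⟩ :
      B.carrier ≃+* (LeftBrace.isGamma.transport e).brace.carrier)⟩⟩
  change e (a * b) = e a + gammaTransport e LeftBrace.gamma (e a) (e b)
  rw [gammaTransport_apply, e.symm_apply_apply, e.symm_apply_apply, LeftBrace.gamma_apply,
    map_sub, add_sub_cancel]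

theorem BundledLeftBrace.HasMulGroup.congr {B C : BundledLeftBrace} {G : Type} [Group G]
    (h : B ≈ C) (hC : C.HasMulGroup G) : B.HasMulGroup G := by
  obtain ⟨e⟩ := h
  obtain ⟨f⟩ := hC
  exact ⟨e.toMulEquiv.trans f⟩

theorem BundledLeftBrace.HasAddGroup.congr {B C : BundledLeftBrace} {G : Type} [AddGroup G]
    (h : B ≈ C) (hC : C.HasAddGroup G) : B.HasAddGroup G := by
  obtain ⟨e⟩ := h
  obtain ⟨f⟩ := hC
  exact ⟨e.toAddEquiv.trans f⟩

theorem BundledLeftBrace.ncard_classes {ι : Type*} [Fintype ι] (S : Set BundledLeftBrace)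
    (rep : ι → BundledLeftBrace) (hmem : ∀ i, rep i ∈ S)
    (hsurj : ∀ B ∈ S, ∃ i, B ≈ rep i) (hinj : ∀ i j, rep i ≈ rep j → i = j) :
    Set.ncard ((fun B => (⟦B⟧ : Quotient isoSetoid)) '' S) = Fintype.card ι := by
  have : (fun B => (⟦B⟧ : Quotient isoSetoid)) '' S =
      Set.range (fun i => (⟦rep i⟧ : Quotient isoSetoid)) := by
    ext x
    constructor
    · rintro ⟨B, hB, rfl⟩
      obtain ⟨i, hi⟩ := hsurj B hB
      exact ⟨i, (Quotient.sound hi).symm⟩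
    · rintro ⟨i, rfl⟩
      exact ⟨rep i, hmem i, rfl⟩
  rw [this, ← Nat.card_coe_set_eq, ← Nat.card_eq_fintype_card]
  exact Nat.card_range_of_injective fun i j hij => hinj i j (Quotient.exact hij)

/-- If the multiplicative group of a brace is an `ℓ`-group, then the fixed points of each of its
actions on a finite set `X` are congruent in number to `X` modulo `ℓ`. -/
theorem IsGamma.card_modEq_card_fixed {V X : Type*} [AddCommGroup V]
    [Finite X] {lam : V → (V ≃+ V)} (h : IsGamma lam) {ℓ n : ℕ} [Fact ℓ.Prime]
    (hV : Nat.card V = ℓ ^ n) (β : V → X → X) (h0 : ∀ x, β 0 x = x)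
    (hβ : ∀ a b x, β (a + lam a b) x = β a (β b x)) :
    Nat.card X ≡ Nat.card {x | ∀ a, β a x = x} [MOD ℓ] := by
  let _ : Group V := h.leftBrace.toGroup
  let _ : MulAction V X :=
    { smul := β
      one_smul := h0
      mul_smul := hβ }
  exact (IsPGroup.of_card hV).card_modEq_card_fixedPoints X

/-- Lagrange's theorem in the multiplicative group, which has as many elements as `V`. -/
theorem IsGamma.pow_eq_one_of_map_mul {V M : Type*} [AddCommGroup V] [Monoid M]
    {lam : V → (V ≃+ V)} (h : IsGamma lam) (m : V → M) (h0 : m 0 = 1)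
    (hm : ∀ a b, m (a + lam a b) = m a * m b) (a : V) : m a ^ Nat.card V = 1 := by
  let _ : Group V := h.leftBrace.toGroup
  let μ : V →* M := ⟨⟨m, h0⟩, hm⟩
  change μ a ^ _ = 1
  rw [← map_pow, pow_card_eq_one', map_one]

/-! ### Automorphisms of a plane and braces of order `ℓ²` -/

/-- The additive automorphism `(x, y) ↦ (x + c y, y)`. -/
def shear {R : Type*} [CommRing R] (c : R) : R × R ≃+ R × R where
  toFun v := (v.1 + c * v.2, v.2)
  invFun v := (v.1 - c * v.2, v.2)
  left_inv v := by simp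
  right_inv v := by simp
  map_add' v w := by ext <;> simp; ring

theorem shear_apply {R : Type*} [CommRing R] (c : R) (v : R × R) :
    shear c v = (v.1 + c * v.2, v.2) := rfl

/-- The additive automorphism `(x, y) ↦ (a x, b y)`. -/
def diagEquiv {R : Type*} [CommRing R] (a b : Rˣ) : R × R ≃+ R × R where
  toFun v := (a * v.1, b * v.2)
  invFun v := (↑a⁻¹ * v.1, ↑b⁻¹ * v.2)
  left_inv v := by simp
  right_inv v := by simp
  map_add' v w := by ext <;> simp <;> ring

theorem diagEquiv_apply {R : Type*} [CommRing R] (a b : Rˣ) (v : R × R) :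
    diagEquiv a b v = (a * v.1, b * v.2) := rfl

/-- The additive automorphism given by an invertible matrix. -/
theorem exists_addEquiv_of_det {K : Type*} [Field K] (a b c d : K) (h : a * d - b * c ≠ 0) :
    ∃ f : K × K ≃+ K × K, ∀ v, f v = (a * v.1 + b * v.2, c * v.1 + d * v.2) :=
  ⟨{ toFun := fun v => (a * v.1 + b * v.2, c * v.1 + d * v.2)
     invFun := fun v => ((d * v.1 - b * v.2) / (a * d - b * c),
      (a * v.2 - c * v.1) / (a * d - b * c))
     left_inv := fun v => by
      ext
      · dsimp only; rw [div_eq_iff h]; ring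
      · dsimp only; rw [div_eq_iff h]; ring
     right_inv := fun v => by
      ext
      · dsimp only; rw [mul_div_assoc', mul_div_assoc', ← add_div, div_eq_iff h]; ring
      · dsimp only; rw [mul_div_assoc', mul_div_assoc', ← add_div, div_eq_iff h]; ring
     map_add' := fun v w => by ext <;> simp <;> ring }, fun _ => rfl⟩

theorem ZMod.map_pair {n : ℕ} {M F : Type*} [AddCommGroup M] [Module (ZMod n) M]
    [FunLike F (ZMod n × ZMod n) M] [AddMonoidHomClass F (ZMod n × ZMod n) M] (f : F)
    (v : ZMod n × ZMod n) : f v = v.1 • f (1, 0) + v.2 • f (0, 1) := by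
  rw [← ZMod.map_smul, ← ZMod.map_smul, ← map_add]
  simp

/-- An additive automorphism moving the nonzero vector `e` to `(1, 0)`. -/
theorem exists_addEquiv_map_eq {K : Type*} [Field K] (e : K × K) (he : e ≠ 0) :
    ∃ f : K × K ≃+ K × K, f e = (1, 0) := by
  obtain ⟨a, b⟩ := e
  by_cases ha : a = 0
  · have hb : b ≠ 0 := by rintro rfl; exact he (by rw [ha]; rfl)
    obtain ⟨f, hf⟩ := exists_addEquiv_of_det (0 : K) b⁻¹ 1 0 (by simpa using hb)
    exact ⟨f, by rw [hf]; simp [ha, hb]⟩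
  · obtain ⟨f, hf⟩ := exists_addEquiv_of_det (a⁻¹ : K) 0 (-b / a) 1 (by simpa using ha)
    refine ⟨f, by rw [hf]; simp [ha]⟩

/-- The coefficient `0` or `1` of a Boolean. -/
def boolCoef (R : Type*) [CommRing R] (e : Bool) : R := bif e then 1 else 0

@[simp] theorem boolCoef_true (R : Type*) [CommRing R] : boolCoef R true = 1 := rfl
@[simp] theorem boolCoef_false (R : Type*) [CommRing R] : boolCoef R false = 0 := rfl

theorem ZMod.card_prod_self {n : ℕ} : Nat.card (ZMod n × ZMod n) = n ^ 2 := by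
  rw [Nat.card_prod, Nat.card_zmod, sq]

section Plane

variable {ℓ : ℕ} [Fact ℓ.Prime]

/-- A brace on `(ℤ/ℓ)²` becomes unitriangular in a suitable basis. -/
theorem IsGamma.exists_unitriangular
    {lam : ZMod ℓ × ZMod ℓ → (ZMod ℓ × ZMod ℓ ≃+ ZMod ℓ × ZMod ℓ)} (h : IsGamma lam) :
    ∃ (f : ZMod ℓ × ZMod ℓ ≃+ ZMod ℓ × ZMod ℓ) (c : ZMod ℓ × ZMod ℓ → ZMod ℓ),
      ∀ v w, gammaTransport f lam v w = shear (c v) w := by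
  have hcard := h.card_modEq_card_fixed ZMod.card_prod_self (fun a x => lam a x)
    (fun x => by rw [h.lam_zero]; rfl) h
  have hdvd : ℓ ∣ Nat.card {x | ∀ a, lam a x = x} := by
    rw [ZMod.card_prod_self] at hcard
    exact (Nat.modEq_zero_iff_dvd.mp (hcard.symm.trans
      (Nat.modEq_zero_iff_dvd.mpr (dvd_pow_self _ two_ne_zero))))
  -- The number of fixed vectors is divisible by `ℓ`, so `0` is not the only one.
  obtain ⟨e, he, he0⟩ : ∃ e, (∀ a, lam a e = e) ∧ e ≠ 0 := by
    by_contra! hne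
    have : {x | ∀ a, lam a x = x} = {0} := by
      ext x
      refine ⟨fun hx => hne x hx, ?_⟩
      rintro rfl a
      exact map_zero _
    rw [this] at hdvd
    simp only [Nat.card_unique, Nat.dvd_one] at hdvd
    exact (Fact.out : ℓ.Prime).ne_one hdvd
  obtain ⟨f, hf⟩ := exists_addEquiv_map_eq e he0
  set lam' := gammaTransport f lam with hlam'
  have h' : IsGamma lam' := h.transport f
  have hfix : ∀ v, lam' v (1, 0) = (1, 0) := fun v => by
    rw [hlam', gammaTransport_apply, ← hf, f.symm_apply_apply, he]
  have hform : ∀ v w, lam' v w = (w.1 + w.2 * (lam' v (0, 1)).1, w.2 * (lam' v (0, 1)).2) := by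
    intro v w
    rw [ZMod.map_pair (lam' v) w, hfix]
    ext <;> simp
  -- The lower diagonal entry is multiplicative in `v`, so its `ℓ²`-th power is `1`; but raising to
  -- the power `ℓ` is the identity on `ℤ/ℓ`.
  have hone : ∀ v, (lam' v (0, 1)).2 = 1 := by
    intro v
    have h1 := h'.pow_eq_one_of_map_mul (fun v => (lam' v (0, 1)).2) (by rw [h'.lam_zero]; rfl)
      (fun a b => by
        rw [h' a b, hform a (lam' b (0, 1))]
        exact mul_comm _ _) v
    rwa [ZMod.card_prod_self, sq, pow_mul, ZMod.pow_card, ZMod.pow_card] at h1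
  refine ⟨f, fun v => (lam' v (0, 1)).1, fun v w => ?_⟩
  rw [hform, hone, shear_apply, mul_comm, mul_one]

/-- A unitriangular brace on `(ℤ/ℓ)²` has its off-diagonal entry linear in the second coordinate. -/
theorem IsGamma.shear_coef
    {lam : ZMod ℓ × ZMod ℓ → (ZMod ℓ × ZMod ℓ ≃+ ZMod ℓ × ZMod ℓ)} (h : IsGamma lam)
    (c : ZMod ℓ × ZMod ℓ → ZMod ℓ) (hc : ∀ v w, lam v w = shear (c v) w) :
    ∃ m, ∀ v, c v = m * v.2 := by
  have hadd : ∀ v w, c (v.1 + (w.1 + c v * w.2), v.2 + w.2) = c v + c w := by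
    intro v w
    have := congrArg Prod.fst (h v w (0, 1))
    simp only [hc, shear_apply, mul_one, zero_add] at this
    rw [add_comm (c v)]
    exact this
  have hx : ∀ v x, c (v.1 + x, v.2) = c v + c (x, 0) := by
    intro v x
    simpa using hadd v (x, 0)
  let κ : ZMod ℓ →+ ZMod ℓ := AddMonoidHom.mk' (fun x => c (x, 0)) fun x y => by
    simpa using hx (x, 0) y
  have hκ : ∀ x, c (x, 0) = x * c (1, 0) := by
    intro x
    have := ZMod.map_smul κ x 1
    simpa [κ] using this
  have hsplit : ∀ x y, c (x, y) = x * c (1, 0) + c (0, y) := by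
    intro x y
    have := hx (0, y) x
    simp only [zero_add] at this
    rw [this, hκ, add_comm]
  set k := c (1, 0) with hk
  have hm : ∀ y y', c (0, y + y') = c (0, y) + c (0, y') - k * c (0, y) * y' := by
    intro y y'
    have := hadd (0, y) (0, y')
    simp only [zero_add] at this
    rw [hsplit] at this
    linear_combination this
  -- If `k ≠ 0`, the symmetry of `y + y'` in `hm` makes `c (0, y)` linear; then `y = y' = 1` kills
  -- its slope, and evaluating at `(1, 0)`, `(0, 1)` leaves `k² = 0`. This argument also covers `ℓ =
  -- 2`.
  have hk0 : k = 0 := by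
    by_contra hk0
    have hm0 : ∀ y, c (0, y) = c (0, 1) * y := by
      intro y
      have h1 := hm y 1
      have h2 := hm 1 y
      rw [add_comm 1 y] at h2
      have h3 : k * (c (0, y) - c (0, 1) * y) = 0 := by linear_combination h1 - h2
      exact sub_eq_zero.mp ((mul_eq_zero.mp h3).resolve_left hk0)
    have h1 := hm 1 1
    rw [hm0 (1 + 1)] at h1
    have h2 : k * c (0, 1) = 0 := by linear_combination h1
    have h3 := hadd (1, 0) (0, 1)
    simp only [zero_add, mul_one] at h3
    rw [hsplit, ← hk] at h3
    have h4 : k * k = 0 := by linear_combination h3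
    exact hk0 (mul_self_eq_zero.mp h4)
  rw [hk0] at hsplit hm
  let μ : ZMod ℓ →+ ZMod ℓ := AddMonoidHom.mk' (fun y => c (0, y)) fun x y => by
    simpa using hm x y
  refine ⟨c (0, 1), fun v => ?_⟩
  have := ZMod.map_smul μ v.2 1
  obtain ⟨x, y⟩ := v
  rw [hsplit]
  simpa [μ, mul_comm] using this

/-- The braces on `(ℤ/ℓ)²`: up to isomorphism the trivial one and
`λ (x, y) = (x' + y y', y')`. -/
theorem IsGamma.exists_conj_shear
    {lam : ZMod ℓ × ZMod ℓ → (ZMod ℓ × ZMod ℓ ≃+ ZMod ℓ × ZMod ℓ)} (h : IsGamma lam) :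
    ∃ (f : ZMod ℓ × ZMod ℓ ≃+ ZMod ℓ × ZMod ℓ) (e : Bool),
      ∀ v w, f (lam v w) = shear (boolCoef _ e * (f v).2) (f w) := by
  obtain ⟨f, c, hc⟩ := h.exists_unitriangular
  obtain ⟨m, hm⟩ := (h.transport f).shear_coef c hc
  have hf : ∀ v w, f (lam v w) = shear (m * (f v).2) (f w) := by
    intro v w
    rw [← hm, ← hc, gammaTransport_apply, f.symm_apply_apply, f.symm_apply_apply]
  by_cases hm0 : m = 0
  · exact ⟨f, false, fun v w => by rw [hf, hm0]; simp⟩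
  -- Dividing the first coordinate by `m` normalises the coefficient to `1`.
  · refine ⟨f.trans (diagEquiv (Units.mk0 m hm0)⁻¹ 1), true, fun v w => ?_⟩
    simp only [AddEquiv.trans_apply, hf, diagEquiv_apply, shear_apply, boolCoef_true]
    ext
    · simp only [Units.val_inv_eq_inv_val, Units.val_mk0, Units.val_one]
      field_simp
    · simp

end Plane

/-! ### Splitting into a semidirect product of braces -/

theorem eq_zero_of_coprime_nsmul {M : Type*} [AddCommGroup M] {n m : ℕ} (hnm : n.Coprime m)
    {x : M} (hn : n • x = 0) (hm : m • x = 0) : x = 0 := by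
  have h1 := addOrderOf_dvd_of_nsmul_eq_zero hn
  have h2 := addOrderOf_dvd_of_nsmul_eq_zero hm
  exact AddMonoid.addOrderOf_eq_one_iff.mp (Nat.eq_one_of_dvd_coprimes hnm h1 h2)

/-- Automorphisms of a product of groups of coprime exponents are products of automorphisms. -/
theorem AddEquiv.exists_prodCongr {V W V' W' : Type*} [AddCommGroup V] [AddCommGroup W]
    [AddCommGroup V'] [AddCommGroup W'] {n m : ℕ} (hnm : n.Coprime m)
    (hV : ∀ v : V, n • v = 0) (hW : ∀ w : W, m • w = 0)
    (hV' : ∀ v : V', n • v = 0) (hW' : ∀ w : W', m • w = 0) (f : V × W ≃+ V' × W') :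
    ∃ (g : V ≃+ V') (h : W ≃+ W'), ∀ v w, f (v, w) = (g v, h w) := by
  have key1 : ∀ v, (f (v, 0)).2 = 0 := fun v => by
    refine eq_zero_of_coprime_nsmul hnm ?_ (hW' _)
    rw [← Prod.smul_snd, ← map_nsmul, Prod.smul_mk, hV, smul_zero]
    change (f 0).2 = 0
    rw [map_zero]; rfl
  have key2 : ∀ w, (f (0, w)).1 = 0 := fun w => by
    refine eq_zero_of_coprime_nsmul hnm (hV' _) ?_
    rw [← Prod.smul_fst, ← map_nsmul, Prod.smul_mk, hW, smul_zero]
    change (f 0).1 = 0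
    rw [map_zero]; rfl
  have key3 : ∀ v, (f.symm (v, 0)).2 = 0 := fun v => by
    refine eq_zero_of_coprime_nsmul hnm ?_ (hW _)
    rw [← Prod.smul_snd, ← map_nsmul, Prod.smul_mk, hV', smul_zero]
    change (f.symm 0).2 = 0
    rw [map_zero]; rfl
  have key4 : ∀ w, (f.symm (0, w)).1 = 0 := fun w => by
    refine eq_zero_of_coprime_nsmul hnm (hV _) ?_
    rw [← Prod.smul_fst, ← map_nsmul, Prod.smul_mk, hW', smul_zero]
    change (f.symm 0).1 = 0
    rw [map_zero]; rfl
  have e1 : ∀ v, f (v, 0) = ((f (v, 0)).1, 0) := fun v => Prod.ext rfl (key1 v)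
  have e2 : ∀ w, f (0, w) = (0, (f (0, w)).2) := fun w => Prod.ext (key2 w) rfl
  have e3 : ∀ v, f.symm (v, 0) = ((f.symm (v, 0)).1, 0) := fun v => Prod.ext rfl (key3 v)
  have e4 : ∀ w, f.symm (0, w) = (0, (f.symm (0, w)).2) := fun w => Prod.ext (key4 w) rfl
  refine ⟨{ toFun := fun v => (f (v, 0)).1
            invFun := fun v => (f.symm (v, 0)).1
            left_inv := fun v => by
              dsimp only; rw [← e1, f.symm_apply_apply]
            right_inv := fun v => by
              dsimp only; rw [← e3, f.apply_symm_apply]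
            map_add' := fun v w => by
              rw [← Prod.fst_add, ← map_add, Prod.mk_add_mk, add_zero] },
          { toFun := fun v => (f (0, v)).2
            invFun := fun v => (f.symm (0, v)).2
            left_inv := fun v => by
              dsimp only; rw [← e2, f.symm_apply_apply]
            right_inv := fun v => by
              dsimp only; rw [← e4, f.apply_symm_apply]
            map_add' := fun v w => by
              rw [← Prod.snd_add, ← map_add, Prod.mk_add_mk, add_zero] }, fun v w => ?_⟩
  change f (v, w) = ((f (v, 0)).1, (f (0, w)).2)
  rw [show (v, w) = (v, 0) + (0, w) by simp, map_add, e1, e2]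
  simp

/-- The brace on `V × W` is a semidirect product as soon as the elements of `V` act trivially
on `W`. -/
theorem IsGamma.exists_semidirect {V W : Type*} [AddCommGroup V] [AddCommGroup W] {n m : ℕ}
    (hnm : n.Coprime m) (hV : ∀ v : V, n • v = 0) (hW : ∀ w : W, m • w = 0)
    {lam : V × W → (V × W ≃+ V × W)} (h : IsGamma lam)
    (htriv : ∀ (lamV : V → (V ≃+ V)) (β : V → (W ≃+ W)), IsGamma lamV →
      (∀ a b x, β (a + lamV a b) x = β a (β b x)) → ∀ a x, β a x = x) :
    ∃ (α : V → (V ≃+ V)) (β : W → (W ≃+ W)) (ρ : W → (V ≃+ V)), IsGamma α ∧ IsGamma β ∧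
      (∀ v w x y, lam (v, w) (x, y) = (α v (ρ w x), β w y)) ∧
      (∀ w w' x, ρ (w + β w w') x = ρ w (ρ w' x)) ∧
      (∀ w v x, ρ w (α v x) = α (ρ w v) (ρ w x)) := by
  choose A B hAB using fun a => AddEquiv.exists_prodCongr hnm hV hW hV hW (lam a)
  have hB : ∀ v w, B (v, 0) w = w := by
    refine htriv (fun v => A (v, 0)) (fun v => B (v, 0)) (fun a b c => ?_) fun a b x => ?_
    · have := congrArg Prod.fst (h (a, 0) (b, 0) (c, 0))
      simpa [hAB] using this
    · have := congrArg Prod.snd (h (a, 0) (b, 0) (0, x))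
      simpa [hAB] using this
  -- As `V` fixes `W`, the brace product of `(v, 0)` and `(0, w)` is `(v, w)`.
  have hmul : ∀ v w x y, lam (v, w) (x, y) = (A (v, 0) (A (0, w) x), B (0, w) y) := by
    intro v w x y
    have := h (v, 0) (0, w) (x, y)
    simpa [hAB, hB] using this
  refine ⟨fun v => A (v, 0), fun w => B (0, w), fun w => A (0, w), fun a b c => ?_,
    fun a b c => ?_, hmul, fun w w' x => ?_, fun w v x => ?_⟩
  · have := congrArg Prod.fst (h (a, 0) (b, 0) (c, 0))
    simpa [hAB] using this
  · have := congrArg Prod.snd (h (0, a) (0, b) (0, c))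
    simpa [hAB] using this
  · have := congrArg Prod.fst (h (0, w) (0, w') (x, 0))
    simpa [hAB] using this
  -- The brace product `(0, w) (v, 0)` equals `(ρ w v, w)`, which is also the product `(ρ w v, 0)
  -- (0, w)`.
  · have := congrArg Prod.fst (h (0, w) (v, 0) (x, 0))
    rw [hAB (0, w) v 0, map_zero, Prod.mk_add_mk, zero_add, add_zero, hmul, hAB (v, 0), hAB] at this
    exact this.symm

/-- A group of order `q ^ 2` acts trivially on `(ℤ/p)²` when `q` does not divide `p ^ 2 - 1`. -/
theorem IsGamma.action_trivial {p q : ℕ} [Fact p.Prime] [Fact q.Prime] (hpq : p < q)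
    (hq : ¬ q ∣ p ^ 2 - 1) (lamV : ZMod q × ZMod q → (ZMod q × ZMod q ≃+ ZMod q × ZMod q))
    (β : ZMod q × ZMod q → (ZMod p × ZMod p ≃+ ZMod p × ZMod p)) (h : IsGamma lamV)
    (hβ : ∀ a b x, β (a + lamV a b) x = β a (β b x)) (a : ZMod q × ZMod q)
    (x : ZMod p × ZMod p) : β a x = x := by
  have hp : p.Prime := Fact.out
  have h0 : ∀ x, β 0 x = x := fun x => by
    have := hβ 0 0 x
    rw [map_zero, add_zero] at this
    exact ((β 0).injective this).symm
  have hcard := h.card_modEq_card_fixed ZMod.card_prod_self (fun a x => β a x) h0 hβ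
  let F : AddSubgroup (ZMod p × ZMod p) :=
    { carrier := {x | ∀ a, β a x = x}
      add_mem' := fun {x y} hx hy a => by rw [map_add, hx, hy]
      zero_mem' := fun a => map_zero _
      neg_mem' := fun {x} hx a => by rw [map_neg, hx] }
  change Nat.card (ZMod p × ZMod p) ≡ Nat.card F [MOD q] at hcard
  have hdvd := F.card_addSubgroup_dvd_card
  rw [ZMod.card_prod_self] at hcard hdvd
  obtain ⟨k, hk, hFk⟩ := (Nat.dvd_prime_pow hp).mp hdvd
  have hF : F = ⊤ := by
    rw [← AddSubgroup.card_eq_iff_eq_top, ZMod.card_prod_self, hFk]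
    by_contra hne
    rw [hFk] at hcard
    have hp2 : ¬ q ∣ p := fun hd => absurd (Nat.le_of_dvd hp.pos hd) (not_le.mpr hpq)
    have hdv := (Nat.modEq_iff_dvd' (Nat.pow_le_pow_right hp.pos hk)).mp hcard.symm
    apply hq
    -- The fixed subgroup has order `p ^ k` with `p ^ 2 ≡ p ^ k` modulo `q`; both `k = 0` and `k =
    -- 1` would give `q ∣ p ^ 2 - 1`.
    interval_cases k
    · simpa using hdv
    · rw [show p ^ 2 - p ^ 1 = p * (p - 1) by
        rw [Nat.mul_sub, pow_one, sq, mul_one]] at hdv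
      rw [show p ^ 2 - 1 = (p + 1) * (p - 1) by rw [← Nat.sq_sub_sq]]
      exact (((Fact.out : q.Prime).dvd_mul.mp hdv).resolve_left hp2).mul_left _
    · exact absurd rfl hne
  have : x ∈ F := hF ▸ AddSubgroup.mem_top x
  exact this a

/-! ### Characters of `(ℤ/p)²` with values in `(ℤ/q)ˣ` and diagonalisation -/

section Characters

variable {p q : ℕ} [Fact p.Prime] [Fact q.Prime]

/-- The character `z ↦ u ^ z` of `ℤ/p`, for `u ^ p = 1`. -/
def unitChar (u : (ZMod q)ˣ) (hu : u ^ p = 1) (z : ZMod p) : (ZMod q)ˣ :=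
  zmodPowHom p u hu (Multiplicative.ofAdd z)

theorem unitChar_add (u : (ZMod q)ˣ) (hu : u ^ p = 1) (a b : ZMod p) :
    unitChar u hu (a + b) = unitChar u hu a * unitChar u hu b := by
  rw [unitChar, ofAdd_add, map_mul]; rfl

theorem unitChar_zero (u : (ZMod q)ˣ) (hu : u ^ p = 1) : unitChar u hu 0 = 1 := by
  rw [unitChar, ofAdd_zero, map_one]

theorem unitChar_intCast (u : (ZMod q)ˣ) (hu : u ^ p = 1) (i : ℤ) :
    unitChar u hu (i : ZMod p) = u ^ i := by
  have h1 : unitChar u hu 1 = u := by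
    have : Fact (1 < p) := ⟨(Fact.out : p.Prime).one_lt⟩
    simp [unitChar, zmodPowHom, ZMod.val_one]
  conv_rhs => rw [← h1]
  rw [unitChar, unitChar, ← map_zpow, ← ofAdd_zsmul, zsmul_one]

theorem unitChar_injective {u : (ZMod q)ˣ} (hu : u ^ p = 1) (hu1 : u ≠ 1) :
    Function.Injective (unitChar u hu) := by
  intro a b hab
  have ho : orderOf u = p := orderOf_eq_prime hu hu1
  have h1 : u ^ a.val = u ^ b.val := hab
  exact ZMod.val_injective p (pow_injOn_Iio_orderOf (by rw [ho]; exact a.val_lt)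
    (by rw [ho]; exact b.val_lt) h1)

/-- The standard pairing on `K²`. -/
def planePair {K : Type*} [CommRing K] (χ w : K × K) : K := χ.1 * w.1 + χ.2 * w.2

theorem planePair_add {K : Type*} [CommRing K] (χ w w' : K × K) :
    planePair χ (w + w') = planePair χ w + planePair χ w' := by
  simp only [planePair, Prod.fst_add, Prod.snd_add]; ring

theorem planePair_add_left {K : Type*} [CommRing K] (χ χ' w : K × K) :
    planePair (χ + χ') w = planePair χ w + planePair χ' w := by
  simp only [planePair, Prod.fst_add, Prod.snd_add]; ring

/-- Orthogonality of characters, one coordinate at a time. It makes the isotypic projections add up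
to a multiple of the identity. -/
theorem sum_unitChar {u : (ZMod q)ˣ} (hu : u ^ p = 1) (hu1 : u ≠ 1) (w : ZMod p × ZMod p) :
    ∑ χ : ZMod p × ZMod p, (unitChar u hu (planePair χ w) : ZMod q) =
      if w = 0 then (p : ZMod q) ^ 2 else 0 := by
  let ψ : AddChar (ZMod p) (ZMod q) :=
    { toFun := fun z => unitChar u hu z
      map_zero_eq_one' := by rw [unitChar_zero]; rfl
      map_add_eq_mul' := fun a b => by rw [unitChar_add]; rfl }
  have hψ : ψ.IsPrimitive := by
    apply AddChar.IsPrimitive.of_ne_one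
    intro h
    have h1 : (unitChar u hu 1 : ZMod q) = 1 := by
      change ψ 1 = 1
      rw [h]; rfl
    have h2 := unitChar_injective hu hu1 ((Units.ext h1).trans (unitChar_zero u hu).symm)
    exact one_ne_zero h2
  have hsum : ∀ b : ZMod p, ∑ a : ZMod p, ψ (a * b) = if b = 0 then (p : ZMod q) else 0 := by
    intro b
    rw [AddChar.sum_mulShift b hψ, ZMod.card]
    split_ifs <;> simp
  have hterm : ∀ χ : ZMod p × ZMod p,
      (unitChar u hu (planePair χ w) : ZMod q) = ψ (χ.1 * w.1) * ψ (χ.2 * w.2) := fun χ => by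
    rw [planePair, unitChar_add, Units.val_mul]; rfl
  rw [Finset.sum_congr rfl fun χ _ => hterm χ, Fintype.sum_prod_type]
  simp only [← Finset.mul_sum, ← Finset.sum_mul, hsum]
  obtain ⟨x, y⟩ := w
  by_cases hx : x = 0 <;> by_cases hy : y = 0 <;> simp [hx, hy, sq]

/-- Common eigenvectors outside any given hyperplane, for an action of `(ℤ/p)²` on `(ℤ/q)²`. -/
theorem exists_common_eigenvector (hpq : p < q) {u : (ZMod q)ˣ} (hu : u ^ p = 1) (hu1 : u ≠ 1)
    (ρ : ZMod p × ZMod p → (ZMod q × ZMod q ≃+ ZMod q × ZMod q))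
    (hρ : ∀ w w' x, ρ (w + w') x = ρ w (ρ w' x)) (φ : ZMod q × ZMod q →+ ZMod q) (hφ : φ ≠ 0) :
    ∃ (χ : ZMod p × ZMod p) (e : ZMod q × ZMod q), φ e ≠ 0 ∧
      ∀ w, ρ w e = (unitChar u hu (planePair χ w) : ZMod q) • e := by
  have hρ0 : ∀ x, ρ 0 x = x := fun x => by
    have := hρ 0 0 x
    rw [add_zero] at this
    exact ((ρ 0).injective this).symm
  -- `π χ` is `p²` times the projection to the `χ`-eigenspace. These maps sum to the invertible
  -- scalar `p²`, so their images cannot all lie in the kernel of `φ`.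
  let π (χ : ZMod p × ZMod p) (v : ZMod q × ZMod q) : ZMod q × ZMod q :=
    ∑ w : ZMod p × ZMod p, (unitChar u hu (planePair χ (-w)) : ZMod q) • ρ w v
  have hπ : ∀ χ v w, ρ w (π χ v) = (unitChar u hu (planePair χ w) : ZMod q) • π χ v := by
    intro χ v w
    simp only [π]
    rw [map_sum, Finset.smul_sum]
    refine Fintype.sum_equiv (Equiv.addLeft w) _ _ fun w' => ?_
    rw [ZMod.map_smul, ← hρ, smul_smul, ← Units.val_mul, ← unitChar_add, ← planePair_add,
      Equiv.coe_addLeft, neg_add, add_neg_cancel_left]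
  have hsum : ∀ v, ∑ χ, π χ v = (p : ZMod q) ^ 2 • v := by
    intro v
    simp only [π]
    rw [Finset.sum_comm]
    simp only [← Finset.sum_smul, sum_unitChar hu hu1, neg_eq_zero, ite_smul, zero_smul]
    rw [Finset.sum_ite_eq' Finset.univ 0, if_pos (Finset.mem_univ _), hρ0]
  by_contra! hne
  apply hφ
  refine AddMonoidHom.ext fun v => ?_
  have h1 : ((p : ZMod q) ^ 2) • φ v = 0 := by
    rw [← ZMod.map_smul, ← hsum, map_sum]
    refine Finset.sum_eq_zero fun χ _ => ?_
    by_contra h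
    obtain ⟨w, hw⟩ := hne χ (π χ v) h
    exact hw (hπ χ v w)
  have hp0 : (p : ZMod q) ≠ 0 := by
    rw [Ne, ZMod.natCast_eq_zero_iff]
    exact fun hd => absurd (Nat.le_of_dvd (Fact.out : p.Prime).pos hd) (not_le.mpr hpq)
  exact (smul_eq_zero.mp h1).resolve_left (pow_ne_zero 2 hp0)

/-- Simultaneous diagonalisation compatible with a brace structure on `(ℤ/q)²`. -/
theorem exists_diagonalisation (hpq : p < q) {u : (ZMod q)ˣ} (hu : u ^ p = 1) (hu1 : u ≠ 1)
    (ρ : ZMod p × ZMod p → (ZMod q × ZMod q ≃+ ZMod q × ZMod q))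
    (hρ : ∀ w w' x, ρ (w + w') x = ρ w (ρ w' x)) (e : Bool)
    (he : ∀ w v x, ρ w (shear (boolCoef _ e * v.2) x) =
      shear (boolCoef _ e * (ρ w v).2) (ρ w x)) :
    ∃ (f : ZMod q × ZMod q ≃+ ZMod q × ZMod q) (χ ψ : ZMod p × ZMod p),
      (e = true → χ = ψ + ψ) ∧
      (∀ v w, f (shear (boolCoef _ e * v.2) w) = shear (boolCoef _ e * (f v).2) (f w)) ∧
      ∀ w x, f (ρ w x) = diagEquiv (unitChar u hu (planePair χ w))
        (unitChar u hu (planePair ψ w)) (f x) := by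
  cases e with
  | false =>
    obtain ⟨χ, e₁, h₁, hχ⟩ := exists_common_eigenvector hpq hu hu1 ρ hρ
      (AddMonoidHom.fst (ZMod q) (ZMod q)) fun h => by
        simpa using DFunLike.congr_fun h ((1, 0) : ZMod q × ZMod q)
    have h₁ : e₁.1 ≠ 0 := h₁
    -- The kernel of `φ` is the line through `e₁`, so an eigenvector outside it completes a basis.
    let φ : ZMod q × ZMod q →+ ZMod q :=
      AddMonoidHom.mk' (fun v => e₁.1 * v.2 - v.1 * e₁.2) fun v w => by
        simp only [Prod.fst_add, Prod.snd_add]; ring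
    obtain ⟨ψ, e₂, h₂, hψ⟩ := exists_common_eigenvector hpq hu hu1 ρ hρ φ fun h => by
      have := DFunLike.congr_fun h ((0, 1) : ZMod q × ZMod q)
      exact h₁ (by simpa [φ] using this)
    have h₂ : e₁.1 * e₂.2 - e₂.1 * e₁.2 ≠ 0 := h₂
    obtain ⟨g, hg⟩ := exists_addEquiv_of_det e₁.1 e₂.1 e₁.2 e₂.2 h₂
    have hg' : ∀ v, g v = v.1 • e₁ + v.2 • e₂ := fun v => by
      rw [hg]; ext <;> simp [mul_comm]
    refine ⟨g.symm, χ, ψ, fun h => absurd h Bool.false_ne_true, fun v w => by simp [shear_apply],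
      fun w x => ?_⟩
    obtain ⟨y, rfl⟩ := g.surjective x
    rw [AddEquiv.symm_apply_eq, g.symm_apply_apply, hg' y, map_add, ZMod.map_smul, ZMod.map_smul,
      hχ, hψ, hg', diagEquiv_apply, smul_smul, smul_smul, mul_comm y.1, mul_comm y.2]
  | true =>
    simp only [boolCoef_true, one_mul] at he ⊢
    obtain ⟨ψ, e₂, h₂, hψ⟩ := exists_common_eigenvector hpq hu hu1 ρ hρ
      (AddMonoidHom.snd (ZMod q) (ZMod q)) fun h => by
        simpa using DFunLike.congr_fun h ((0, 1) : ZMod q × ZMod q)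
    have h₂ : e₂.2 ≠ 0 := h₂
    obtain ⟨t, ht⟩ : ∃ t : ZMod q, ∀ w, ρ w (t, 1) =
        (unitChar u hu (planePair ψ w) : ZMod q) • (t, 1) := by
      refine ⟨e₂.2⁻¹ * e₂.1, fun w => ?_⟩
      have : ((e₂.2⁻¹ * e₂.1, 1) : ZMod q × ZMod q) = e₂.2⁻¹ • e₂ := by
        ext <;> simp [h₂]
      rw [this, ZMod.map_smul, hψ, smul_comm]
    -- The vector `(1, 0)` is `λ_(t,1) (t, 1) - (t, 1)`; since `ρ w` respects the brace and scales
    -- `(t, 1)` by `ψ`, it scales `(1, 0)` by `ψ²`.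
    have h₁ : ∀ w, ρ w (1, 0) =
        ((unitChar u hu (planePair ψ w) * unitChar u hu (planePair ψ w) : ZMod q), 0) := by
      intro w
      have := he w (t, 1) (t, 1)
      have hs : shear (1 : ZMod q) (t, 1) = (t, 1) + (1, 0) := by simp [shear_apply]
      rw [hs, map_add, ht] at this
      ext
      · have := congrArg Prod.fst this
        simpa [shear_apply] using this
      · have := congrArg Prod.snd this
        simpa [shear_apply] using this
    -- This shear moves the eigenvector `(t, 1)` to `(0, 1)`, and it is a brace automorphism: it
    -- keeps second coordinates and commutes with all shears.
    refine ⟨shear (-t), ψ + ψ, ψ, fun _ => rfl, fun v w => ?_, fun w x => ?_⟩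
    · simp only [shear_apply]
      ext
      · dsimp only; ring
      · rfl
    · have hx : x = (x.1 - t * x.2) • ((1, 0) : ZMod q × ZMod q) + x.2 • ((t, 1) : ZMod q × ZMod q) := by
        ext <;> simp; ring
      conv_lhs => rw [hx]
      rw [map_add, ZMod.map_smul, ZMod.map_smul, ht, h₁]
      simp only [shear_apply, diagEquiv_apply, planePair_add_left, unitChar_add, Units.val_mul]
      ext
      · simp; ring
      · simp; ring

end Characters

/-! ### Model braces attached to characters -/

/-- Parameters of a brace with additive group `(ℤ/q)² × (ℤ/p)²`: whether the braces on the two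
factors are non-trivial, and the two characters of the action. -/
structure BraceDatum (p : ℕ) where
  eq : Bool
  ep : Bool
  fst : ZMod p × ZMod p
  snd : ZMod p × ZMod p

/-- The action preserves the brace structure on `(ℤ/q)²`. -/
def BraceDatum.Valid {p : ℕ} (D : BraceDatum p) : Prop := D.eq = true → D.fst = D.snd + D.snd

/-- The map straightening the multiplicative group of a brace on the plane. -/
def straighten {K : Type*} [Field K] (c : K) : K × K ≃ K × K where
  toFun w := (w.1 - c * w.2 ^ 2 / 2, w.2)
  invFun w := (w.1 + c * w.2 ^ 2 / 2, w.2)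
  left_inv w := by simp
  right_inv w := by simp

theorem straighten_apply {K : Type*} [Field K] (c : K) (w : K × K) :
    straighten c w = (w.1 - c * w.2 ^ 2 / 2, w.2) := rfl

/-- The quadratic form `y² / 2` polarises to `y y'`, so `straighten` is an isomorphism from the
multiplicative group of a plane brace to its additive group. -/
theorem straighten_add_shear {K : Type*} [Field K] (h2 : (2 : K) ≠ 0) (c : K) (v w : K × K) :
    straighten c (v + shear (c * v.2) w) = straighten c v + straighten c w := by
  simp only [straighten_apply, shear_apply]
  ext
  · simp only [Prod.fst_add, Prod.snd_add]
    field_simp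
    ring
  · rfl

section Model

variable {p q : ℕ} [Fact p.Prime] [Fact q.Prime] (u : (ZMod q)ˣ) (hu : u ^ p = 1)

namespace BraceDatum

/-- The character pairs of `D` as an action on the plane. -/
def diag (D : BraceDatum p) (w : ZMod p × ZMod p) : ZMod q × ZMod q ≃+ ZMod q × ZMod q :=
  diagEquiv (unitChar u hu (planePair D.fst w)) (unitChar u hu (planePair D.snd w))

theorem diag_add (D : BraceDatum p) (w w' : ZMod p × ZMod p) (x : ZMod q × ZMod q) :
    D.diag u hu (w + w') x = D.diag u hu w (D.diag u hu w' x) := by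
  simp only [diag, diagEquiv_apply, planePair_add, unitChar_add, Units.val_mul, mul_assoc]

/-- The gamma function of the brace with parameters `D`. -/
def gamma (D : BraceDatum p) (a : (ZMod q × ZMod q) × (ZMod p × ZMod p)) :
    (ZMod q × ZMod q) × (ZMod p × ZMod p) ≃+ (ZMod q × ZMod q) × (ZMod p × ZMod p) :=
  AddEquiv.prodCongr ((D.diag u hu (straighten (boolCoef _ D.ep) a.2)).trans
    (shear (boolCoef _ D.eq * a.1.2))) (shear (boolCoef _ D.ep * a.2.2))

theorem gamma_apply (D : BraceDatum p) (v x : ZMod q × ZMod q) (w y : ZMod p × ZMod p) :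
    D.gamma u hu (v, w) (x, y) = (shear (boolCoef _ D.eq * v.2)
      (D.diag u hu (straighten (boolCoef _ D.ep) w) x), shear (boolCoef _ D.ep * w.2) y) := rfl

/-- With a non-trivial brace on the `q`-part, validity makes the diagonal entries `d²` and `d`, the
shape of a brace automorphism. -/
theorem diag_shear {D : BraceDatum p} (hD : D.Valid) (w : ZMod p × ZMod p)
    (v x : ZMod q × ZMod q) : D.diag u hu w (shear (boolCoef _ D.eq * v.2) x) =
      shear (boolCoef _ D.eq * (D.diag u hu w v).2) (D.diag u hu w x) := by
  simp only [diag, diagEquiv_apply, shear_apply]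
  cases h : D.eq with
  | false => simp
  | true =>
    rw [hD h, planePair_add_left, unitChar_add, Units.val_mul, boolCoef_true]
    ext
    · dsimp only; ring
    · rfl

theorem isGamma (h2 : (2 : ZMod p) ≠ 0) {D : BraceDatum p} (hD : D.Valid) :
    IsGamma (D.gamma u hu) := by
  rintro ⟨v, w⟩ ⟨v', w'⟩ ⟨x, y⟩
  rw [gamma_apply, Prod.mk_add_mk, gamma_apply, gamma_apply, gamma_apply, straighten_add_shear h2,
    diag_add, diag_shear u hu hD]
  simp only [shear_apply]
  ext
  · simp only [Prod.snd_add]; ring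
  · rfl
  · simp only [Prod.snd_add]; ring
  · rfl

end BraceDatum

variable {u}

theorem ZMod.nsmul_pair {n : ℕ} (v : ZMod n × ZMod n) : n • v = 0 := by
  ext <;> simp

/-- Classification: every gamma function on `(ℤ/q)² × (ℤ/p)²` is equivalent to a model. -/
theorem IsGamma.exists_datum (h2 : (2 : ZMod p) ≠ 0) (hpq : p < q) (hq : ¬ q ∣ p ^ 2 - 1)
    (hu1 : u ≠ 1) {lam : (ZMod q × ZMod q) × (ZMod p × ZMod p) →
      ((ZMod q × ZMod q) × (ZMod p × ZMod p) ≃+ (ZMod q × ZMod q) × (ZMod p × ZMod p))}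
    (h : IsGamma lam) : ∃ (D : BraceDatum p) (_ : D.Valid)
      (f : (ZMod q × ZMod q) × (ZMod p × ZMod p) ≃+ (ZMod q × ZMod q) × (ZMod p × ZMod p)),
      ∀ a b, f (lam a b) = D.gamma u hu (f a) (f b) := by
  have hcop : q.Coprime p :=
    (Nat.coprime_primes Fact.out Fact.out).mpr hpq.ne'
  obtain ⟨α, β, ρ, hα, hβ, hlam, hρβ, hρα⟩ := h.exists_semidirect hcop ZMod.nsmul_pair
    ZMod.nsmul_pair fun lamV β hV hβ => hV.action_trivial hpq hq lamV β hβ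
  obtain ⟨fV, eq, hfV⟩ := hα.exists_conj_shear
  obtain ⟨fW, ep, hfW⟩ := hβ.exists_conj_shear
  let s : ZMod p × ZMod p ≃ ZMod p × ZMod p := straighten (boolCoef _ ep)
  -- Undoing `fW` and the straightening sends addition on `(ℤ/p)²` to the multiplication of the
  -- brace `β`, so `ρ` can be treated as an action of an elementary abelian group.
  have hs : ∀ w w', fW.symm (s.symm (w + w')) =
      fW.symm (s.symm w) + β (fW.symm (s.symm w)) (fW.symm (s.symm w')) := by
    intro w w'
    rw [AddEquiv.symm_apply_eq, map_add fW, hfW, Equiv.symm_apply_eq, straighten_add_shear h2]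
    simp [s]
  obtain ⟨g, χ, ψ, hval, hg1, hg2⟩ := exists_diagonalisation hpq hu hu1
    (fun w => (fV.symm.trans (ρ (fW.symm (s.symm w)))).trans fV)
    (fun w w' x => by
      simp only [AddEquiv.trans_apply, AddEquiv.symm_apply_apply, hs, hρβ]) eq
    (fun w v x => by
      simp only [AddEquiv.trans_apply]
      rw [← hfV, ← hρα]
      congr 2
      rw [AddEquiv.symm_apply_eq, hfV, fV.apply_symm_apply, fV.apply_symm_apply])
  refine ⟨⟨eq, ep, χ, ψ⟩, hval, AddEquiv.prodCongr (fV.trans g) fW, ?_⟩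
  rintro ⟨v, w⟩ ⟨x, y⟩
  have := hg2 (s (fW w)) (fV x)
  simp only [AddEquiv.trans_apply, AddEquiv.symm_apply_apply, Equiv.symm_apply_apply] at this
  rw [hlam]
  change (g (fV (α v (ρ w x))), fW (β w y)) = BraceDatum.gamma u hu _ (g (fV v), fW w) (g (fV x), fW y)
  rw [BraceDatum.gamma_apply, hfV, hg1, this, hfW]
  rfl

end Model

/-! ### Isomorphisms of model braces and of their multiplicative groups -/

section Plane

variable {ℓ : ℕ} [Fact ℓ.Prime]

/-- `f` is a homomorphism between the braces on the plane given by `e` and `e'`. -/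
def PlaneHom (e e' : Bool) (f : ZMod ℓ × ZMod ℓ ≃+ ZMod ℓ × ZMod ℓ) : Prop :=
  ∀ v w, f (shear (boolCoef _ e * v.2) w) = shear (boolCoef _ e' * (f v).2) (f w)

theorem PlaneHom.eq {e e' : Bool} {f : ZMod ℓ × ZMod ℓ ≃+ ZMod ℓ × ZMod ℓ}
    (h : PlaneHom e e' f) : e = e' := by
  cases e <;> cases e'
  · rfl
  · exfalso
    have := h (f.symm (0, 1)) (f.symm (0, 1))
    simp [shear_apply] at this
  · exfalso
    have := h (0, 1) (0, 1)
    simp [shear_apply] at this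
  · rfl

/-- In the non-trivial brace `λ_(0,1) (0, 1) - (0, 1) = (1, 0)`, so the image of `(0, 1)` determines
that of `(1, 0)`. -/
theorem PlaneHom.map_fst {f : ZMod ℓ × ZMod ℓ ≃+ ZMod ℓ × ZMod ℓ} (h : PlaneHom true true f) :
    f (1, 0) = ((f (0, 1)).2 ^ 2, 0) := by
  have := h (0, 1) (0, 1)
  have hs : shear (1 : ZMod ℓ) (0, 1) = (0, 1) + (1, 0) := by simp [shear_apply]
  simp only [boolCoef_true, one_mul] at this
  rw [hs, map_add, shear_apply] at this
  ext
  · have := congrArg Prod.fst this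
    simpa [sq] using this
  · have := congrArg Prod.snd this
    simpa using this

theorem PlaneHom.apply_eq {f : ZMod ℓ × ZMod ℓ ≃+ ZMod ℓ × ZMod ℓ} (h : PlaneHom true true f)
    (v : ZMod ℓ × ZMod ℓ) :
    f v = ((f (0, 1)).2 ^ 2 * v.1 + (f (0, 1)).1 * v.2, (f (0, 1)).2 * v.2) := by
  rw [ZMod.map_pair f v, h.map_fst]
  ext <;> simp [mul_comm]

/-- The automorphisms are `(x, y) ↦ (d² x + b y, d y)`, and `d² · y²/2 = (d y)²/2`. -/
theorem PlaneHom.straighten {e : Bool} {f : ZMod ℓ × ZMod ℓ ≃+ ZMod ℓ × ZMod ℓ}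
    (h : PlaneHom e e f) (w : ZMod ℓ × ZMod ℓ) :
    f (straighten (boolCoef _ e) w) = straighten (boolCoef _ e) (f w) := by
  cases e with
  | false => simp [straighten_apply]
  | true =>
    rw [h.apply_eq, h.apply_eq w, straighten_apply, straighten_apply]
    ext
    · simp only [boolCoef_true]; ring
    · rfl

theorem ZMod.det_ne_zero (f : ZMod ℓ × ZMod ℓ ≃+ ZMod ℓ × ZMod ℓ) :
    (f (1, 0)).1 * (f (0, 1)).2 - (f (0, 1)).1 * (f (1, 0)).2 ≠ 0 := by
  intro h0
  have h1 : f ((f (0, 1)).2, -(f (1, 0)).2) = 0 := by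
    rw [ZMod.map_pair f]
    ext
    · simp only [Prod.fst_add, Prod.smul_fst, smul_eq_mul, Prod.fst_zero]
      linear_combination h0
    · simp only [Prod.snd_add, Prod.smul_snd, smul_eq_mul, Prod.snd_zero]; ring
  have h2 : f ((f (0, 1)).1, -(f (1, 0)).1) = 0 := by
    rw [ZMod.map_pair f]
    ext
    · simp only [Prod.fst_add, Prod.smul_fst, smul_eq_mul, Prod.fst_zero]; ring
    · simp only [Prod.snd_add, Prod.smul_snd, smul_eq_mul, Prod.snd_zero]
      linear_combination -h0
  rw [map_eq_zero_iff f f.injective] at h1 h2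
  have h3 : f (1, 0) = 0 := by
    ext
    · simpa using congrArg Prod.snd h2
    · simpa using congrArg Prod.snd h1
  rw [map_eq_zero_iff f f.injective] at h3
  simpa using congrArg Prod.fst h3

end Plane

theorem diagGL_mulVec {R : Type*} [CommRing R] (a b : Rˣ) (x y : R) :
    (diagGL a b).val.mulVec ![x, y] = ![a * x, b * y] := by
  funext i
  fin_cases i <;> simp [diagGL, mul_comm]

namespace BraceDatum

/-- The datum with the same characters and with trivial braces on the two factors. -/
def trivialize {p : ℕ} (D : BraceDatum p) : BraceDatum p := ⟨false, false, D.fst, D.snd⟩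

variable {p q : ℕ} [Fact p.Prime] [Fact q.Prime] {u : (ZMod q)ˣ} (hu : u ^ p = 1)

/-- The characters of `D` are those of `D'` composed with `g`, in the same order. -/
def Straight (D D' : BraceDatum p) (g : ZMod p × ZMod p → ZMod p × ZMod p) : Prop :=
  (∀ w, planePair D.fst w = planePair D'.fst (g w)) ∧
    ∀ w, planePair D.snd w = planePair D'.snd (g w)

/-- The characters of `D` are those of `D'` composed with `g`, in the opposite order. -/
def Swapped (D D' : BraceDatum p) (g : ZMod p × ZMod p → ZMod p × ZMod p) : Prop :=
  (∀ w, planePair D.fst w = planePair D'.snd (g w)) ∧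
    ∀ w, planePair D.snd w = planePair D'.fst (g w)

/-- Parameters of isomorphic braces. -/
def Equivalent (D D' : BraceDatum p) : Prop :=
  D.eq = D'.eq ∧ D.ep = D'.ep ∧ ∃ g : ZMod p × ZMod p ≃+ ZMod p × ZMod p,
    PlaneHom D.ep D.ep g ∧ (Straight D D' g ∨ D.eq = false ∧ Swapped D D' g)

/-- Parameters of braces with isomorphic multiplicative groups. -/
def MulEquivalent (D D' : BraceDatum p) : Prop :=
  ∃ g : ZMod p × ZMod p ≃+ ZMod p × ZMod p, Straight D D' g ∨ Swapped D D' g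

/-- A matrix with non-zero determinant has a non-zero diagonal or antidiagonal product. Comparing
the corresponding coordinates of the images of the two basis eigenvectors identifies the characters.
The clause on `f (1, 0)` later excludes swapping when the brace on `V` is non-trivial. -/
theorem straight_or_swapped (hu1 : u ≠ 1) {D D' : BraceDatum p}
    (f : ZMod q × ZMod q ≃+ ZMod q × ZMod q) (g : ZMod p × ZMod p → ZMod p × ZMod p)
    (hfg : ∀ w x, f (D.diag u hu w x) = D'.diag u hu (g w) (f x)) :
    Straight D D' g ∨ (f (1, 0)).2 ≠ 0 ∧ Swapped D D' g := by
  have cancel : ∀ {a b : ZMod p} {c : ZMod q}, c ≠ 0 →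
      (unitChar u hu a : ZMod q) * c = unitChar u hu b * c → a = b := fun hc h =>
    unitChar_injective hu hu1 (Units.ext (mul_right_cancel₀ hc h))
  have h1 : ∀ w, (unitChar u hu (planePair D.fst w) : ZMod q) • f (1, 0) =
      D'.diag u hu (g w) (f (1, 0)) := fun w => by
    rw [← hfg, ← ZMod.map_smul]
    congr 1
    simp [diag, diagEquiv_apply]
  have h2 : ∀ w, (unitChar u hu (planePair D.snd w) : ZMod q) • f (0, 1) =
      D'.diag u hu (g w) (f (0, 1)) := fun w => by
    rw [← hfg, ← ZMod.map_smul]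
    congr 1
    simp [diag, diagEquiv_apply]
  have hdet := ZMod.det_ne_zero f
  by_cases had : (f (1, 0)).1 * (f (0, 1)).2 = 0
  · rw [had, zero_sub, neg_ne_zero] at hdet
    exact Or.inr ⟨right_ne_zero_of_mul hdet,
      fun w => cancel (right_ne_zero_of_mul hdet) (congrArg Prod.snd (h1 w)),
      fun w => cancel (left_ne_zero_of_mul hdet) (congrArg Prod.fst (h2 w))⟩
  · exact Or.inl ⟨fun w => cancel (left_ne_zero_of_mul had) (congrArg Prod.fst (h1 w)),
      fun w => cancel (right_ne_zero_of_mul had) (congrArg Prod.snd (h2 w))⟩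

theorem Straight.diag_eq {D D' : BraceDatum p} {g : ZMod p × ZMod p → ZMod p × ZMod p}
    (h : Straight D D' g) (w : ZMod p × ZMod p) :
    D.diag u hu w = D'.diag u hu (g w) := by
  rw [diag, diag, h.1, h.2]

theorem Swapped.diag_eq {D D' : BraceDatum p} {g : ZMod p × ZMod p → ZMod p × ZMod p}
    (h : Swapped D D' g) (w : ZMod p × ZMod p) (x : ZMod q × ZMod q) :
    (D.diag u hu w x).swap = D'.diag u hu (g w) x.swap := by
  rw [diag, diag, h.1, h.2]; rfl

/-- The criterion for two model braces to be isomorphic. -/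
theorem exists_gamma_equiv_iff (hpq : p < q) (hu1 : u ≠ 1) (D D' : BraceDatum p) :
    (∃ f : (ZMod q × ZMod q) × (ZMod p × ZMod p) ≃+ (ZMod q × ZMod q) × (ZMod p × ZMod p),
      ∀ a b, f (D.gamma u hu a b) = D'.gamma u hu (f a) (f b)) ↔ Equivalent D D' := by
  constructor
  · rintro ⟨f, hf⟩
    have hcop : q.Coprime p := (Nat.coprime_primes Fact.out Fact.out).mpr hpq.ne'
    obtain ⟨fV, fW, hfVW⟩ := AddEquiv.exists_prodCongr hcop ZMod.nsmul_pair ZMod.nsmul_pair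
      ZMod.nsmul_pair ZMod.nsmul_pair f
    have hdiag0 : ∀ (D : BraceDatum p) x, D.diag u hu 0 x = x := fun D x => by
      simp [diag, diagEquiv_apply, planePair, unitChar_zero]
    have hst0 : ∀ c : ZMod p, straighten c 0 = 0 := fun c => by simp [straighten_apply]
    have hV : PlaneHom D.eq D'.eq fV := fun v x => by
      have := congrArg Prod.fst (hf (v, 0) (x, 0))
      simpa [gamma_apply, hfVW, hst0, hdiag0] using this
    have hW : PlaneHom D.ep D'.ep fW := fun v x => by
      have := congrArg Prod.snd (hf (0, v) (0, x))
      simpa [gamma_apply, hfVW] using this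
    have heq := hV.eq
    have hep := hW.eq
    have hW' : PlaneHom D.ep D.ep fW := by
      conv => arg 2; rw [hep]
      exact hW
    refine ⟨heq, hep, fW, hW', ?_⟩
    have hdiag : ∀ w x, fV (D.diag u hu w x) = D'.diag u hu (fW w) (fV x) := by
      intro w x
      obtain ⟨w, rfl⟩ := (straighten (boolCoef _ D.ep)).surjective w
      have := congrArg Prod.fst (hf (0, w) (x, 0))
      rw [hW'.straighten]
      simpa [gamma_apply, hfVW, shear_apply, hep] using this
    rcases straight_or_swapped hu hu1 fV fW hdiag with h | ⟨h0, h⟩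
    · exact Or.inl h
    · refine Or.inr ⟨?_, h⟩
      rw [Bool.eq_false_iff]
      intro ht
      rw [← heq, ht] at hV
      exact h0 (by rw [hV.map_fst])
  -- On the `q`-part the identity or the exchange of coordinates suffices.
  · rintro ⟨heq, hep, g, hg, h | ⟨h0, h⟩⟩
    · refine ⟨AddEquiv.prodCongr (AddEquiv.refl _) g, ?_⟩
      rintro ⟨v, w⟩ ⟨x, y⟩
      change (_, g _) = D'.gamma u hu (v, g w) (x, g y)
      rw [gamma_apply, ← hep, ← heq, ← hg, ← hg.straighten, ← h.diag_eq]
      rfl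
    · refine ⟨AddEquiv.prodCongr AddEquiv.prodComm g, ?_⟩
      rintro ⟨v, w⟩ ⟨x, y⟩
      change ((D.gamma u hu (v, w) (x, y)).1.swap, g (D.gamma u hu (v, w) (x, y)).2) = D'.gamma u hu (v.swap, g w) (x.swap, g y)
      rw [gamma_apply, gamma_apply, ← hep, ← heq, ← hg, ← hg.straighten, ← h.diag_eq, h0]
      simp [shear_apply]
      rfl

/-- The multiplicative group depends only on the characters. -/
theorem exists_mul_equiv_trivialize (h2 : (2 : ZMod p) ≠ 0) (h2q : (2 : ZMod q) ≠ 0)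
    {D : BraceDatum p} (hD : D.Valid) :
    ∃ f : (ZMod q × ZMod q) × (ZMod p × ZMod p) ≃ (ZMod q × ZMod q) × (ZMod p × ZMod p),
      ∀ a b, f (a + D.gamma u hu a b) = f a + D.trivialize.gamma u hu (f a) (f b) := by
  refine ⟨Equiv.prodCongr (straighten (boolCoef _ D.eq)) (straighten (boolCoef _ D.ep)), ?_⟩
  rintro ⟨v, w⟩ ⟨x, y⟩
  -- Straightening the `q`-part commutes with the action because the latter is by brace
  -- automorphisms.
  have hc := PlaneHom.straighten (diag_shear u hu hD (straighten (boolCoef _ D.ep) w)) x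
  simp only [Equiv.prodCongr_apply, Prod.map_apply, gamma_apply, Prod.mk_add_mk,
    straighten_add_shear h2, straighten_add_shear h2q, ← hc]
  simp [trivialize, shear_apply, straighten_apply, diag]

/-- Coprimality forces a group isomorphism to preserve the normal subgroup `V`, hence to induce maps
`fV` and `fW` on it and on the quotient. Comparing the images of `(0, w) (x, 0)` and `(ρ_w x, 0) (0,
w)` shows that these intertwine the actions. -/
theorem mulEquivalent_of_equiv (hpq : p < q) (hu1 : u ≠ 1) {D D' : BraceDatum p}
    (f : (ZMod q × ZMod q) × (ZMod p × ZMod p) ≃ (ZMod q × ZMod q) × (ZMod p × ZMod p))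
    (hf : ∀ a b, f (a + D.trivialize.gamma u hu a b) =
      f a + D'.trivialize.gamma u hu (f a) (f b)) : MulEquivalent D D' := by
  have hcop : q.Coprime p := (Nat.coprime_primes Fact.out Fact.out).mpr hpq.ne'
  have hdiag0 : ∀ (D : BraceDatum p) x, D.diag u hu 0 x = x := fun D x => by
    simp [diag, diagEquiv_apply, planePair, unitChar_zero]
  have hgam : ∀ (D : BraceDatum p) v w x y,
      (v, w) + D.trivialize.gamma u hu (v, w) (x, y) = (v + D.diag u hu w x, w + y) := by
    intro D v w x y
    rw [gamma_apply]
    simp [trivialize, shear_apply, straighten_apply, diag]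
  have hmul : ∀ v w x y, f (v + D.diag u hu w x, w + y) =
      ((f (v, w)).1 + D'.diag u hu (f (v, w)).2 (f (x, y)).1, (f (v, w)).2 + (f (x, y)).2) := by
    intro v w x y
    rw [← hgam, hf, ← hgam]
  have hVW : ∀ v, (f (v, 0)).2 = 0 := by
    intro v
    let φ : ZMod q × ZMod q →+ ZMod p × ZMod p :=
      AddMonoidHom.mk' (fun v => (f (v, 0)).2) fun v x => by
        have := congrArg Prod.snd (hmul v 0 x 0)
        simpa [hdiag0] using this
    refine eq_zero_of_coprime_nsmul (x := φ v) hcop ?_ (ZMod.nsmul_pair _)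
    rw [← map_nsmul, ZMod.nsmul_pair, map_zero]
  let fV' : ZMod q × ZMod q →+ ZMod q × ZMod q :=
    AddMonoidHom.mk' (fun v => (f (v, 0)).1) fun v x => by
      have := congrArg Prod.fst (hmul v 0 x 0)
      simpa [hdiag0, hVW] using this
  let fV : ZMod q × ZMod q ≃+ ZMod q × ZMod q := AddEquiv.ofBijective fV'
    (Finite.injective_iff_bijective.mp fun v x hvx => by
      have : f (v, 0) = f (x, 0) := Prod.ext hvx (by rw [hVW, hVW])
      simpa using f.injective this)
  let fW' : ZMod p × ZMod p →+ ZMod p × ZMod p :=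
    AddMonoidHom.mk' (fun w => (f (0, w)).2) fun w y => by
      have := congrArg Prod.snd (hmul 0 w 0 y)
      simpa using this
  have hsnd : ∀ v w, (f (v, w)).2 = fW' w := by
    intro v w
    have := congrArg Prod.snd (hmul v 0 0 w)
    simpa [hVW, fW'] using this
  let fW : ZMod p × ZMod p ≃+ ZMod p × ZMod p := AddEquiv.ofBijective fW'
    (Finite.surjective_iff_bijective.mp fun w => by
      obtain ⟨⟨v, y⟩, hvy⟩ := f.surjective (0, w)
      exact ⟨y, by rw [← hsnd v, hvy]⟩)
  have hdiag : ∀ w x, fV (D.diag u hu w x) = D'.diag u hu (fW w) (fV x) := by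
    intro w x
    have h1 := congrArg Prod.fst (hmul 0 w x 0)
    have h2 := congrArg Prod.fst (hmul (D.diag u hu w x) 0 0 w)
    simp only [zero_add, add_zero, hVW, hdiag0] at h1 h2
    rw [h1, add_comm] at h2
    exact (add_right_cancel h2).symm
  exact ⟨fW, (straight_or_swapped hu hu1 fV fW hdiag).imp id And.right⟩

theorem MulEquivalent.trivialize_equivalent {D D' : BraceDatum p} (h : MulEquivalent D D') :
    Equivalent D.trivialize D'.trivialize := by
  obtain ⟨g, hg⟩ := h
  refine ⟨rfl, rfl, g, fun v w => by simp [trivialize, shear_apply], hg.imp id fun h => ⟨rfl, h⟩⟩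

variable {hu}

/-- The groups of the form `(ℤ/q)² ⋊ (ℤ/p)²` with diagonal action are the multiplicative groups of
the models with trivial braces on the factors. -/
theorem exists_equiv_semidirectProduct (D : BraceDatum p)
    (η : Multiplicative (ZMod p × ZMod p) →* GL (Fin 2) (ZMod q))
    (hη : ∀ w, η w = diagGL (unitChar u hu (planePair D.fst w.toAdd))
      (unitChar u hu (planePair D.snd w.toAdd))) :
    ∃ f : (ZMod q × ZMod q) × (ZMod p × ZMod p) ≃
      Multiplicative (Fin 2 → ZMod q) ⋊[(glAction q).comp η] Multiplicative (ZMod p × ZMod p),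
      ∀ a b, f (a + D.trivialize.gamma u hu a b) = f a * f b := by
  let eV : ZMod q × ZMod q ≃ Multiplicative (Fin 2 → ZMod q) :=
    (finTwoArrowEquiv (ZMod q)).symm.trans Multiplicative.ofAdd
  refine ⟨(Equiv.prodCongr eV Multiplicative.ofAdd).trans SemidirectProduct.equivProd.symm, ?_⟩
  rintro ⟨v, w⟩ ⟨x, y⟩
  have hgam : D.trivialize.gamma u hu (v, w) (x, y) = (D.diag u hu w x, y) := by
    rw [gamma_apply]
    simp [trivialize, shear_apply, straighten_apply, diag]
  rw [hgam]
  apply SemidirectProduct.ext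
  · change eV (v + D.diag u hu w x) = eV v * glAction q (η (Multiplicative.ofAdd w)) (eV x)
    rw [hη]
    apply Multiplicative.toAdd.injective
    funext i
    fin_cases i
    · change v.1 + unitChar u hu (planePair D.fst w) * x.1 = v.1 + Matrix.mulVec (diagGL
        (unitChar u hu (planePair D.fst w)) (unitChar u hu (planePair D.snd w))).val ![x.1, x.2] 0
      rw [diagGL_mulVec]; rfl
    · change v.2 + unitChar u hu (planePair D.snd w) * x.2 = v.2 + Matrix.mulVec (diagGL
        (unitChar u hu (planePair D.fst w)) (unitChar u hu (planePair D.snd w))).val ![x.1, x.2] 1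
      rw [diagGL_mulVec]; rfl
  · rfl

end BraceDatum

/-! ### Orbits of characters under automorphisms of a plane brace -/

section Pairing

variable {K : Type*} [Field K]

theorem planePair_smul (k : K) (χ w : K × K) : planePair (k • χ) w = k * planePair χ w := by
  simp only [planePair, Prod.smul_fst, Prod.smul_snd, smul_eq_mul]; ring

theorem planePair_ext {χ χ' : K × K} (h : ∀ w, planePair χ w = planePair χ' w) : χ = χ' := by
  ext
  · simpa [planePair] using h (1, 0)
  · simpa [planePair] using h (0, 1)

/-- The action of `(x, y) ↦ (d² x + b y, d y)` on characters. -/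
def charAct (d b : K) (χ : K × K) : K × K := (d ^ 2 * χ.1, b * χ.1 + d * χ.2)

end Pairing

section Orbits

variable {p : ℕ} [Fact p.Prime]

theorem PlaneHom.exists_charAct {g : ZMod p × ZMod p ≃+ ZMod p × ZMod p}
    (hg : PlaneHom true true g) : ∃ d b : ZMod p, d ≠ 0 ∧
      ∀ χ χ', (∀ w, planePair χ w = planePair χ' (g w)) ↔ χ = charAct d b χ' := by
  have hdet := ZMod.det_ne_zero g
  rw [hg.map_fst, mul_zero, sub_zero] at hdet
  have hpair : ∀ χ w, planePair χ (g w) =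
      planePair (charAct (g (0, 1)).2 (g (0, 1)).1 χ) w := fun χ w => by
    rw [hg.apply_eq w]
    simp only [planePair, charAct]; ring
  exact ⟨(g (0, 1)).2, (g (0, 1)).1, right_ne_zero_of_mul hdet, fun χ χ' =>
    ⟨fun h => planePair_ext fun w => by rw [h, hpair], fun h w => by rw [h, hpair]⟩⟩

theorem exists_planeHom_charAct (d b : ZMod p) (hd : d ≠ 0) :
    ∃ g : ZMod p × ZMod p ≃+ ZMod p × ZMod p, PlaneHom true true g ∧
      ∀ χ w, planePair (charAct d b χ) w = planePair χ (g w) := by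
  obtain ⟨g, hg⟩ := exists_addEquiv_of_det (d ^ 2) b 0 d (by simpa using hd)
  refine ⟨g, fun v w => ?_, fun χ w => ?_⟩
  · rw [hg, hg v, hg w]
    simp only [shear_apply, boolCoef_true]
    ext
    · simp only; ring
    · simp only; ring
  · rw [hg]
    simp only [planePair, charAct]; ring

theorem planeHom_false (g : ZMod p × ZMod p ≃+ ZMod p × ZMod p) : PlaneHom false false g :=
  fun v w => by simp [shear_apply]

/-- Representatives of the non-zero characters of the braces on the plane, with the type of the
brace. -/
def orbitType (i : Fin 4) : Bool := i != 0

/-- Representatives of the non-zero characters of the braces on the plane, `n` a non-square. -/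
def orbitChar (n : ZMod p) (i : Fin 4) : ZMod p × ZMod p := ![(1, 0), (0, 1), (1, 0), (n, 0)] i

theorem orbitChar_ne_zero {n : ZMod p} (hn : ¬ IsSquare n) (i : Fin 4) : orbitChar n i ≠ 0 := by
  have hn0 : n ≠ 0 := by rintro rfl; exact hn (IsSquare.zero)
  fin_cases i <;> simp [orbitChar, hn0]

theorem exists_nonsquare (h2 : (2 : ZMod p) ≠ 0) : ∃ n : ZMod p, ¬ IsSquare n := by
  apply FiniteField.exists_nonsquare
  rw [ZMod.ringChar_zmod_n]
  rintro rfl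
  exact h2 (ZMod.natCast_self 2)

theorem isSquare_mul_of_not_isSquare {n m : ZMod p} (hn : ¬ IsSquare n)
    (hm : ¬ IsSquare m) : IsSquare (n * m) := by
  have hn0 : n ≠ 0 := by rintro rfl; exact hn (IsSquare.zero)
  have hm0 : m ≠ 0 := by rintro rfl; exact hm (IsSquare.zero)
  have h1 := (quadraticChar_neg_one_iff_not_isSquare (F := ZMod p)).mpr hn
  have h2 := (quadraticChar_neg_one_iff_not_isSquare (F := ZMod p)).mpr hm
  rw [← quadraticChar_one_iff_isSquare (mul_ne_zero hn0 hm0), map_mul, h1, h2]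
  norm_num

/-- For the trivial brace `GL(2, p)` is transitive. For the other one the first coordinate is scaled
by squares `d²`: if it is non-zero, `b` adjusts the second coordinate and only the square class
matters; if it is zero, `d` scales the second coordinate freely. -/
theorem exists_orbit {n : ZMod p} (hn : ¬ IsSquare n) (e : Bool)
    (χ : ZMod p × ZMod p) (hχ : χ ≠ 0) : ∃ (i : Fin 4) (g : ZMod p × ZMod p ≃+ ZMod p × ZMod p),
      orbitType i = e ∧ PlaneHom e e g ∧ ∀ w, planePair χ w = planePair (orbitChar n i) (g w) := by
  have hn0 : n ≠ 0 := by rintro rfl; exact hn (IsSquare.zero)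
  obtain ⟨a, b⟩ := χ
  cases e with
  | false =>
    have : ∃ c d : ZMod p, a * d - b * c ≠ 0 := by
      by_cases ha : a = 0
      · refine ⟨1, 0, fun h => hχ ?_⟩
        have hb : b = 0 := by simpa using h
        rw [ha, hb]; rfl
      · exact ⟨0, 1, by simpa using ha⟩
    obtain ⟨c, d, hcd⟩ := this
    obtain ⟨g, hg⟩ := exists_addEquiv_of_det a b c d hcd
    exact ⟨0, g, rfl, planeHom_false g, fun w => by simp [hg, planePair, orbitChar]⟩
  | true =>
    suffices ∃ (i : Fin 4) (d b' : ZMod p), i ≠ 0 ∧ d ≠ 0 ∧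
        (a, b) = charAct d b' (orbitChar n i) by
      obtain ⟨i, d, b', hi, hd, h⟩ := this
      obtain ⟨g, hg, hg'⟩ := exists_planeHom_charAct d b' hd
      exact ⟨i, g, by simp [orbitType, hi], hg, fun w => by rw [h, hg']⟩
    by_cases ha : a = 0
    · refine ⟨1, b, 0, by decide, ?_, by simp [charAct, orbitChar, ha]⟩
      rintro rfl
      exact hχ (by rw [ha]; rfl)
    · by_cases hs : IsSquare a
      · obtain ⟨r, hr⟩ := hs
        refine ⟨2, r, b, by decide, ?_, by simp [charAct, orbitChar, hr, sq]⟩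
        rintro rfl
        exact ha (by simpa using hr)
      · obtain ⟨r, hr⟩ := isSquare_mul_of_not_isSquare hs hn
        refine ⟨3, r / n, b / n, by decide, ?_, ?_⟩
        · intro h0
          rw [div_eq_zero_iff, or_iff_left hn0] at h0
          rw [h0, mul_zero] at hr
          exact mul_ne_zero ha hn0 hr
        · simp only [charAct, orbitChar]
          ext
          · change a = (r / n) ^ 2 * n
            field_simp
            linear_combination hr
          · change b = b / n * n + r / n * 0
            field_simp
            ring

/-- Vanishing of the first coordinate and its square class are invariants. The factor `c`
accommodates swapped characters; it preserves square classes if it is a square, and is harmless if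
the class of `n` does not occur. -/
theorem orbit_injective {n : ZMod p} (hn : ¬ IsSquare n) {c : ZMod p} (hc0 : c ≠ 0) {i j : Fin 4}
    (hc : IsSquare c ∨ i ≠ 3 ∧ j ≠ 3)
    (hij : orbitType i = orbitType j) (g : ZMod p × ZMod p ≃+ ZMod p × ZMod p)
    (hg : PlaneHom (orbitType i) (orbitType i) g)
    (h : ∀ w, planePair (orbitChar n i) w = planePair (c • orbitChar n j) (g w)) : i = j := by
  have hn0 : n ≠ 0 := by rintro rfl; exact hn (IsSquare.zero)
  by_cases hi : i = 0
  · subst hi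
    by_contra hj
    simp [orbitType, Ne.symm hj] at hij
  · have hit : orbitType i = true := by simp [orbitType, hi]
    have hjt : j ≠ 0 := by
      rintro rfl
      rw [hit] at hij
      simp [orbitType] at hij
    rw [hit] at hg
    obtain ⟨d, b, hd, hdb⟩ := hg.exists_charAct
    have h1 := congrArg Prod.fst ((hdb _ _).mp h)
    have key1 : 1 ≠ d ^ 2 * (c * n) ∨ ¬ IsSquare c := by
      by_contra! hcon
      obtain ⟨h1, r, rfl⟩ := hcon
      have hr : r ≠ 0 := by rintro rfl; simp at hc0
      exact hn ⟨1 / (d * r), by field_simp; linear_combination -h1⟩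
    have key2 : n ≠ d ^ 2 * c ∨ ¬ IsSquare c := by
      by_contra! hcon
      obtain ⟨h1, r, rfl⟩ := hcon
      exact hn ⟨d * r, by rw [h1]; ring⟩
    fin_cases i <;> fin_cases j <;>
      simp [charAct, orbitChar, hd, hc0, hn0] at h1 hi hjt hc ⊢
    · exact key1.elim (fun h => h h1) (fun h => h hc)
    · exact key2.elim (fun h => h h1) (fun h => h hc)

/-! ### Kinds of character pairs; braces whose characters span a line -/

namespace BraceDatum

/-- The character pair `(1, k)` on a line. -/
def lineDatum (k : ZMod p) : BraceDatum p := ⟨false, false, (1, 0), (k, 0)⟩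

/-- Two independent characters. -/
def faithfulDatum (p : ℕ) : BraceDatum p := ⟨false, false, (0, 1), (1, 1)⟩

/-- Trivial characters. -/
def zeroDatum (p : ℕ) : BraceDatum p := ⟨false, false, 0, 0⟩

theorem mulEquivalent_zeroDatum_iff (D : BraceDatum p) :
    MulEquivalent D (zeroDatum p) ↔ D.fst = 0 ∧ D.snd = 0 := by
  have h0 : ∀ w : ZMod p × ZMod p, planePair 0 w = 0 := fun w => by simp [planePair]
  constructor
  · rintro ⟨g, h | h⟩
    · exact ⟨planePair_ext fun w => by rw [h.1, h0]; exact h0 _,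
        planePair_ext fun w => by rw [h.2, h0]; exact h0 _⟩
    · exact ⟨planePair_ext fun w => by rw [h.1, h0]; exact h0 _,
        planePair_ext fun w => by rw [h.2, h0]; exact h0 _⟩
  · rintro ⟨h1, h2⟩
    exact ⟨AddEquiv.refl _, Or.inl ⟨fun w => by rw [h1, h0]; exact (h0 _).symm,
      fun w => by rw [h2, h0]; exact (h0 _).symm⟩⟩

theorem mulEquivalent_lineDatum_iff (D : BraceDatum p) (k : ZMod p) :
    MulEquivalent D (lineDatum k) ↔
      D.fst ≠ 0 ∧ D.snd = k • D.fst ∨ D.snd ≠ 0 ∧ D.fst = k • D.snd := by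
  have hk : ∀ w : ZMod p × ZMod p, planePair (k, 0) w = k * planePair (1, 0) w := fun w => by
    simp [planePair]
  have key : ∀ (χ ψ : ZMod p × ZMod p) (g : ZMod p × ZMod p ≃+ ZMod p × ZMod p),
      (∀ w, planePair χ w = planePair (1, 0) (g w)) →
      (∀ w, planePair ψ w = planePair (k, 0) (g w)) → χ ≠ 0 ∧ ψ = k • χ := by
    intro χ ψ g h1 h2
    refine ⟨?_, planePair_ext fun w => by rw [planePair_smul, h1, h2, hk]⟩
    rintro rfl
    have := h1 (g.symm (1, 0))
    simp [planePair] at this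
  have key' : ∀ χ : ZMod p × ZMod p, χ ≠ 0 → ∃ g : ZMod p × ZMod p ≃+ ZMod p × ZMod p,
      ∀ w, planePair χ w = planePair (1, 0) (g w) := by
    intro χ hχ
    have : ∃ c d : ZMod p, χ.1 * d - χ.2 * c ≠ 0 := by
      by_cases ha : χ.1 = 0
      · exact ⟨1, 0, fun h => hχ (Prod.ext ha (by simpa using h))⟩
      · exact ⟨0, 1, by simpa using ha⟩
    obtain ⟨c, d, hcd⟩ := this
    obtain ⟨g, hg⟩ := exists_addEquiv_of_det _ _ c d hcd
    exact ⟨g, fun w => by simp [hg, planePair]⟩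
  constructor
  · rintro ⟨g, h | h⟩
    · exact Or.inl (key _ _ g h.1 h.2)
    · exact Or.inr (key _ _ g h.2 h.1)
  · rintro (⟨h0, h⟩ | ⟨h0, h⟩)
    · obtain ⟨g, hg⟩ := key' _ h0
      exact ⟨g, Or.inl ⟨hg, fun w => by rw [h, planePair_smul, hg]; exact (hk _).symm⟩⟩
    · obtain ⟨g, hg⟩ := key' _ h0
      exact ⟨g, Or.inr ⟨fun w => by rw [h, planePair_smul, hg]; exact (hk _).symm, hg⟩⟩

/-- Any two bases of the character group differ by an element of `GL(2, p)`. -/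
theorem mulEquivalent_faithfulDatum_iff (D : BraceDatum p) :
    MulEquivalent D (faithfulDatum p) ↔ D.fst.1 * D.snd.2 - D.fst.2 * D.snd.1 ≠ 0 := by
  constructor
  · rintro ⟨g, h⟩
    have hdet := ZMod.det_ne_zero g
    have e1 : ∀ χ : ZMod p × ZMod p, planePair χ (1, 0) = χ.1 := fun χ => by simp [planePair]
    have e2 : ∀ χ : ZMod p × ZMod p, planePair χ (0, 1) = χ.2 := fun χ => by simp [planePair]
    rw [← e1, ← e2, ← e1 D.snd, ← e2 D.fst]
    rcases h with h | h
    · rw [h.1, h.1, h.2, h.2]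
      simp only [faithfulDatum, planePair]
      contrapose! hdet
      linear_combination -hdet
    · rw [h.1, h.1, h.2, h.2]
      simp only [faithfulDatum, planePair]
      contrapose! hdet
      linear_combination hdet
  · intro h
    -- The characters of `faithfulDatum` read off the second coordinate and the sum of both, so the
    -- rows of `g` are `D.snd - D.fst` and `D.fst`.
    obtain ⟨g, hg⟩ := exists_addEquiv_of_det (D.snd.1 - D.fst.1) (D.snd.2 - D.fst.2)
      D.fst.1 D.fst.2 (by contrapose! h; linear_combination -h)
    refine ⟨g, Or.inl ⟨fun w => ?_, fun w => ?_⟩⟩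
    · rw [hg]; simp only [planePair, faithfulDatum]; ring
    · rw [hg]; simp only [planePair, faithfulDatum]; ring

theorem mulEquivalent_cases (D : BraceDatum p) : MulEquivalent D (zeroDatum p) ∨
    (∃ k, MulEquivalent D (lineDatum k)) ∨ MulEquivalent D (faithfulDatum p) := by
  rw [mulEquivalent_zeroDatum_iff, mulEquivalent_faithfulDatum_iff]
  simp only [mulEquivalent_lineDatum_iff]
  by_cases hdet : D.fst.1 * D.snd.2 - D.fst.2 * D.snd.1 = 0
  · by_cases h1 : D.fst = 0
    · by_cases h2 : D.snd = 0
      · exact Or.inl ⟨h1, h2⟩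
      · exact Or.inr (Or.inl ⟨0, Or.inr ⟨h2, by rw [h1, zero_smul]⟩⟩)
    · refine Or.inr (Or.inl ?_)
      by_cases ha : D.fst.1 = 0
      · have hb : D.fst.2 ≠ 0 := fun hb => h1 (Prod.ext ha hb)
        refine ⟨D.snd.2 / D.fst.2, Or.inl ⟨h1, ?_⟩⟩
        ext
        · simp only [Prod.smul_fst, smul_eq_mul]
          field_simp
          linear_combination -hdet
        · simp only [Prod.smul_snd, smul_eq_mul]
          field_simp
      · refine ⟨D.snd.1 / D.fst.1, Or.inl ⟨h1, ?_⟩⟩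
        ext
        · simp only [Prod.smul_fst, smul_eq_mul]
          field_simp
        · simp only [Prod.smul_snd, smul_eq_mul]
          field_simp
          linear_combination hdet
  · exact Or.inr (Or.inr hdet)

/-- Representatives of the braces whose characters span a line. -/
def lineRep (n k : ZMod p) (x : Bool × Fin 4) : BraceDatum p :=
  ⟨x.1, orbitType x.2, bif x.1 then orbitChar n x.2 + orbitChar n x.2 else orbitChar n x.2,
    bif x.1 then orbitChar n x.2 else k • orbitChar n x.2⟩

/-- The indices of the representatives of the braces whose characters are `χ`, `k χ`. -/
def LineIndex (k : ZMod p) (x : Bool × Fin 4) : Prop :=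
  (x.1 = true → k = 2 ∨ 2 * k = 1) ∧ (x.1 = false → ¬ (k = -1 ∧ p % 4 = 3 ∧ x.2 = 3))

theorem lineRep_valid (n k : ZMod p) (x : Bool × Fin 4) : (lineRep n k x).Valid := by
  intro h
  have : x.1 = true := h
  simp [lineRep, this]

theorem lineRep_mulEquivalent (h2 : (2 : ZMod p) ≠ 0) {n : ZMod p} (hn : ¬ IsSquare n)
    (k : ZMod p) (x : Bool × Fin 4) (hx : LineIndex k x) :
    MulEquivalent (lineRep n k x) (lineDatum k) := by
  rw [mulEquivalent_lineDatum_iff]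
  obtain ⟨e, i⟩ := x
  cases e with
  | false => exact Or.inl ⟨orbitChar_ne_zero hn i, rfl⟩
  | true =>
    simp only [lineRep, cond_true]
    rcases hx.1 rfl with h | h
    · exact Or.inr ⟨orbitChar_ne_zero hn i, by rw [h, two_smul]⟩
    · refine Or.inl ⟨?_, ?_⟩
      · rw [← two_smul (ZMod p)]
        exact smul_ne_zero h2 (orbitChar_ne_zero hn i)
      · rw [← two_smul (ZMod p), smul_smul, mul_comm, h, one_smul]

/-- The only excluded index is `3` with `k = -1` and `p ≡ 3` modulo `4`. Then the swap replaces `χ`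
by `-χ`, whose index is not `3`, since otherwise `-1` would be a square. -/
theorem exists_lineRep_of_fst {n : ZMod p} (hn : ¬ IsSquare n) (k : ZMod p)
    (ep : Bool) (χ : ZMod p × ZMod p) (hχ : χ ≠ 0) : ∃ x, LineIndex k x ∧
      Equivalent ⟨false, ep, χ, k • χ⟩ (lineRep n k x) := by
  obtain ⟨i, g, hi, hg, hgi⟩ := exists_orbit hn ep χ hχ
  by_cases hx : k = -1 ∧ p % 4 = 3 ∧ i = 3
  · obtain ⟨rfl, hp, rfl⟩ := hx
    obtain ⟨j, g', hj, hg', hgj⟩ := exists_orbit hn ep ((-1 : ZMod p) • χ) (by simpa using hχ)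
    refine ⟨(false, j), ⟨fun h => absurd h Bool.false_ne_true, ?_⟩, rfl, hj.symm, g', hg',
      Or.inr ⟨rfl, fun w => ?_, fun w => ?_⟩⟩
    · rintro - ⟨-, -, rfl⟩
      have het : ep = true := hi.symm
      subst het
      obtain ⟨d, b, hd, hdb⟩ := hg.exists_charAct
      obtain ⟨d', b', hd', hdb'⟩ := hg'.exists_charAct
      have h1 := congrArg Prod.fst ((hdb _ _).mp hgi)
      have h2 := congrArg Prod.fst ((hdb' _ _).mp hgj)
      have hn0 : n ≠ 0 := by rintro rfl; exact hn (IsSquare.zero)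
      change χ.1 = d ^ 2 * n at h1
      change ((-1 : ZMod p) • χ).1 = d' ^ 2 * n at h2
      have h3 : (d' ^ 2 + d ^ 2) * n = 0 := by
        have : ((-1 : ZMod p) • χ).1 = - χ.1 := by simp
        rw [this] at h2
        linear_combination -h1 - h2
      have h4 := (mul_eq_zero.mp h3).resolve_right hn0
      have h5 : IsSquare (-1 : ZMod p) := ⟨d' / d, by field_simp; linear_combination -h4⟩
      exact ZMod.exists_sq_eq_neg_one_iff.mp h5 hp
    · change _ = planePair ((-1 : ZMod p) • orbitChar n j) (g' w)
      rw [planePair_smul, ← hgj, ← planePair_smul, smul_smul]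
      simp
    · exact hgj w
  · exact ⟨(false, i), ⟨fun h => absurd h Bool.false_ne_true, fun _ => hx⟩, rfl, hi.symm, g, hg,
      Or.inl ⟨hgi, fun w => by
        change planePair (k • χ) w = planePair (k • orbitChar n i) (g w)
        rw [planePair_smul, planePair_smul, hgi]⟩⟩

/-- If the brace on `V` is non-trivial, the pair is `(2ψ, ψ)`, so the ratio `k` is `1/2` or `2`
according to the order. -/
theorem exists_lineRep {n : ZMod p} (hn : ¬ IsSquare n) (k : ZMod p) (D : BraceDatum p)
    (hD : D.Valid) (h : MulEquivalent D (lineDatum k)) : ∃ x, LineIndex k x ∧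
      Equivalent D (lineRep n k x) := by
  rw [mulEquivalent_lineDatum_iff] at h
  obtain ⟨eq, ep, χ, ψ⟩ := D
  simp only at h
  cases eq with
  | false =>
    rcases h with ⟨hχ, rfl⟩ | ⟨hψ, rfl⟩
    · exact exists_lineRep_of_fst hn k ep χ hχ
    · obtain ⟨x, hx, h1, h2, g, hg, h3⟩ := exists_lineRep_of_fst hn k ep ψ hψ
      refine ⟨x, hx, h1, h2, g, hg, ?_⟩
      rcases h3 with h3 | ⟨-, h3⟩
      · exact Or.inr ⟨rfl, h3.2, h3.1⟩
      · exact Or.inl ⟨h3.2, h3.1⟩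
  | true =>
    obtain rfl : χ = ψ + ψ := hD rfl
    have hψ : ψ ≠ 0 := by
      rintro rfl
      simp at h
    have hk : k = 2 ∨ 2 * k = 1 := by
      simp only [← two_smul (ZMod p) ψ, smul_smul] at h
      rcases h with ⟨-, h⟩ | ⟨-, h⟩
      · right
        have : (2 * k - 1) • ψ = 0 := by
          rw [sub_smul, one_smul, mul_comm, ← h, sub_self]
        exact sub_eq_zero.mp ((smul_eq_zero.mp this).resolve_right hψ)
      · left
        have : (k - 2) • ψ = 0 := by rw [sub_smul, h, sub_self]
        exact sub_eq_zero.mp ((smul_eq_zero.mp this).resolve_right hψ)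
    obtain ⟨i, g, hi, hg, hgi⟩ := exists_orbit hn ep ψ hψ
    exact ⟨(true, i), ⟨fun _ => hk, fun h => absurd h.symm Bool.false_ne_true⟩, rfl, hi.symm, g,
      hg, Or.inl ⟨fun w => by
        change planePair (ψ + ψ) w = planePair (orbitChar n i + orbitChar n i) (g w)
        rw [planePair_add_left, planePair_add_left, hgi], hgi⟩⟩

/-- A swap forces `k² = 1`. For `k = 1`, or `k = -1` a square, orbits are unchanged; for `k = -1` a
non-square, `LineIndex` has already dropped the class of `n`. -/
theorem lineRep_injective {n : ZMod p} (hn : ¬ IsSquare n)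
    (hp : p % 4 = 1 ∨ p % 4 = 3) (k : ZMod p)
    {x y : Bool × Fin 4} (hx : LineIndex k x) (hy : LineIndex k y)
    (h : Equivalent (lineRep n k x) (lineRep n k y)) : x = y := by
  obtain ⟨e, i⟩ := x
  obtain ⟨e', j⟩ := y
  obtain ⟨h1, h2, g, hg, h3⟩ := h
  obtain rfl : e = e' := h1
  have hsq1 : IsSquare (1 : ZMod p) := IsSquare.one
  have hone : (∀ w, planePair (orbitChar n i) w = planePair (orbitChar n j) (g w)) → i = j :=
    fun h => orbit_injective hn one_ne_zero (Or.inl hsq1) h2 g hg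
      (fun w => by rw [one_smul]; exact h w)
  cases e with
  | false =>
    rcases h3 with h3 | ⟨-, h3⟩
    · rw [hone h3.1]
    · have ha : ∀ w, planePair (orbitChar n i) w = planePair (k • orbitChar n j) (g w) := h3.1
      have hb : ∀ w, planePair (k • orbitChar n i) w = planePair (orbitChar n j) (g w) := h3.2
      have hkk : k * k = 1 := by
        have : (k * k) • orbitChar n i = orbitChar n i := planePair_ext fun w => by
          rw [mul_smul, planePair_smul, hb, ← planePair_smul, ← ha]
        have h0 : (k * k - 1) • orbitChar n i = 0 := by rw [sub_smul, this, one_smul, sub_self]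
        exact sub_eq_zero.mp ((smul_eq_zero.mp h0).resolve_right (orbitChar_ne_zero hn i))
      have hk0 : k ≠ 0 := by rintro rfl; simp at hkk
      refine congrArg (Prod.mk false) (orbit_injective hn hk0 ?_ h2 g hg ha)
      rcases mul_self_eq_one_iff.mp hkk with rfl | rfl
      · exact Or.inl hsq1
      · rcases hp with hp | hp
        · exact Or.inl (ZMod.exists_sq_eq_neg_one_iff.mpr (by omega))
        · exact Or.inr ⟨fun h => hx.2 rfl ⟨rfl, hp, h⟩, fun h => hy.2 rfl ⟨rfl, hp, h⟩⟩
  | true =>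
    rcases h3 with h3 | ⟨h0, -⟩
    · rw [hone h3.2]
    · exact absurd h0.symm Bool.false_ne_true

end BraceDatum

end Orbits

/-! ### Counting on a line; normal forms for independent characters -/

namespace BraceDatum

variable {p : ℕ} [Fact p.Prime]

-- The first summand counts the braces that are trivial on `V`, the second those that are not.
open Classical in
theorem card_lineIndex (k : ZMod p) :
    Fintype.card {x // LineIndex k x} =
      (if k = -1 ∧ p % 4 = 3 then 3 else 4) + (if k = 2 ∨ 2 * k = 1 then 4 else 0) := by
  rw [Fintype.card_subtype]
  have : (Finset.univ.filter fun x : Bool × Fin 4 => LineIndex k x) =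
      (Finset.univ.filter fun i : Fin 4 => ¬ ((k = -1 ∧ p % 4 = 3) ∧ i = 3)).map
        ⟨Prod.mk false, Prod.mk_right_injective _⟩ ∪
      (Finset.univ.filter fun _ : Fin 4 => k = 2 ∨ 2 * k = 1).map
        ⟨Prod.mk true, Prod.mk_right_injective _⟩ := by
    ext ⟨e, i⟩
    cases e
    · simp [LineIndex]
    · by_cases h : k = 2 ∨ 2 * k = 1 <;> simp [LineIndex, h]
  rw [this, Finset.card_union_of_disjoint, Finset.card_map, Finset.card_map]
  · congr 1
    · by_cases h : k = -1 ∧ p % 4 = 3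
      · simp only [h, if_true, and_self, true_and]
        decide
      · simp [h]
    · by_cases h : k = 2 ∨ 2 * k = 1 <;> simp [h]
  · rw [Finset.disjoint_left]
    simp

/-- Representatives of the braces with independent characters. -/
def faithfulRep (p : ℕ) (x : ZMod p × Fin ((p + 1) / 2)) : BraceDatum p :=
  if x.1 = 0 then
    -- The normal form with both parameters zero would have dependent characters; its slot is given
    -- to the single class that is trivial on `W`.
    if (x.2 : ℕ) = 0 then faithfulDatum p
    else ⟨false, true, ((x.2 : ℕ), 1), (-(x.2 : ℕ), 1)⟩
  else ⟨false, true, (x.1 + (x.2 : ℕ), -1), (x.1 - (x.2 : ℕ), 1)⟩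

theorem natCast_eq_zero_of_lt_half {n : ℕ} (hn : n < (p + 1) / 2) (h : (n : ZMod p) = 0) :
    n = 0 := by
  rw [ZMod.natCast_eq_zero_iff] at h
  have := (Fact.out : p.Prime).two_le
  exact Nat.eq_zero_of_dvd_of_lt h (by omega)

theorem natCast_inj_of_lt_half (hp : p % 2 = 1) {n m : ℕ} (hn : n < (p + 1) / 2)
    (hm : m < (p + 1) / 2) (h : (n : ZMod p) = m ∨ (n : ZMod p) = -m) : n = m := by
  rcases h with h | h
  · rw [ZMod.natCast_eq_natCast_iff'] at h
    rwa [Nat.mod_eq_of_lt (by omega), Nat.mod_eq_of_lt (by omega)] at h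
  · have : ((n + m : ℕ) : ZMod p) = 0 := by rw [Nat.cast_add, h, neg_add_cancel]
    rw [ZMod.natCast_eq_zero_iff] at this
    have := Nat.eq_zero_of_dvd_of_lt this (by omega)
    omega

theorem exists_natCast_of_sign (hp : p % 2 = 1) (e : ZMod p) :
    ∃ n : Fin ((p + 1) / 2), e = (n : ℕ) ∨ e = -(n : ℕ) := by
  have hlt := e.val_lt
  by_cases h : e.val < (p + 1) / 2
  · exact ⟨⟨e.val, h⟩, Or.inl (by simp)⟩
  · refine ⟨⟨p - e.val, by omega⟩, Or.inr ?_⟩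
    simp [Nat.cast_sub hlt.le]

theorem faithfulRep_mulEquivalent (h2 : (2 : ZMod p) ≠ 0) (x : ZMod p × Fin ((p + 1) / 2)) :
    MulEquivalent (faithfulRep p x) (faithfulDatum p) := by
  rw [mulEquivalent_faithfulDatum_iff]
  simp only [faithfulRep]
  split_ifs with h1 h3
  · simp [faithfulDatum]
  · have : ((x.2 : ℕ) : ZMod p) ≠ 0 := fun h => h3 (natCast_eq_zero_of_lt_half x.2.2 h)
    have := mul_ne_zero h2 this
    contrapose! this
    linear_combination this
  · have := mul_ne_zero h2 h1
    contrapose! this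
    linear_combination this

/-- Isomorphism of data with trivial brace of order `q²` and non-trivial brace of order `p²`. -/
theorem equivalent_true_iff (χ ψ χ' ψ' : ZMod p × ZMod p) :
    Equivalent ⟨false, true, χ, ψ⟩ ⟨false, true, χ', ψ'⟩ ↔ ∃ d b : ZMod p, d ≠ 0 ∧
      (χ = charAct d b χ' ∧ ψ = charAct d b ψ' ∨ χ = charAct d b ψ' ∧ ψ = charAct d b χ') := by
  constructor
  · rintro ⟨-, -, g, hg, h⟩
    obtain ⟨d, b, hd, hdb⟩ := PlaneHom.exists_charAct hg
    refine ⟨d, b, hd, ?_⟩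
    rcases h with h | ⟨-, h⟩
    · exact Or.inl ⟨(hdb _ _).mp h.1, (hdb _ _).mp h.2⟩
    · exact Or.inr ⟨(hdb _ _).mp h.1, (hdb _ _).mp h.2⟩
  · rintro ⟨d, b, hd, h⟩
    obtain ⟨g, hg, hgd⟩ := exists_planeHom_charAct d b hd
    refine ⟨rfl, rfl, g, hg, ?_⟩
    rcases h with ⟨rfl, rfl⟩ | ⟨rfl, rfl⟩
    · exact Or.inl ⟨hgd _, hgd _⟩
    · exact Or.inr ⟨rfl, hgd _, hgd _⟩

theorem faithfulRep_valid {p : ℕ} (x : ZMod p × Fin ((p + 1) / 2)) : (faithfulRep p x).Valid := by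
  intro h
  rw [faithfulRep] at h
  split_ifs at h
  all_goals exact absurd h Bool.false_ne_true

/-- With non-trivial `W`, the parameters `d` and `b` of `charAct` normalise the pair. What remains
is half the sum and half the difference of the first coordinates, the latter up to the sign changed
by a swap. -/
theorem exists_faithfulRep (h2 : (2 : ZMod p) ≠ 0) (hp : p % 2 = 1) (D : BraceDatum p)
    (hD : D.Valid) (h : MulEquivalent D (faithfulDatum p)) :
    ∃ x, Equivalent D (faithfulRep p x) := by
  have hdet := (mulEquivalent_faithfulDatum_iff D).mp h
  obtain ⟨eq, ep, ⟨a₁, b₁⟩, ⟨a₂, b₂⟩⟩ := D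
  simp only at hdet
  cases eq with
  | true =>
    exfalso
    have := hD rfl
    simp only [Prod.mk_add_mk, Prod.mk.injEq] at this
    rw [this.1, this.2] at hdet
    exact hdet (by ring)
  | false =>
    cases ep with
    | false =>
      obtain ⟨g, hg⟩ := h
      refine ⟨(0, ⟨0, by have := (Fact.out : p.Prime).two_le; omega⟩), ?_⟩
      simp only [faithfulRep, if_true]
      exact ⟨rfl, rfl, g, planeHom_false g, hg.imp id fun h => ⟨rfl, h⟩⟩
    | true =>
      by_cases hσ : a₁ + a₂ = 0
      · obtain rfl : a₂ = -a₁ := by linear_combination hσ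
        have ha : a₁ ≠ 0 := by rintro rfl; simp at hdet
        have hb : b₁ + b₂ ≠ 0 := by
          contrapose! hdet
          linear_combination a₁ * hdet
        -- When the first coordinates cancel, `charAct` multiplies the sum of the second ones by
        -- `d`, and that sum is `2` in the normal form.
        set d := (b₁ + b₂) / 2 with hd
        have hd0 : d ≠ 0 := div_ne_zero hb h2
        obtain ⟨n, hn⟩ := exists_natCast_of_sign hp (a₁ / d ^ 2)
        have hn0 : ((n : ℕ) : ZMod p) ≠ 0 := by
          intro h0
          rw [h0, neg_zero, or_self, div_eq_zero_iff] at hn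
          exact hn.elim ha (pow_ne_zero 2 hd0)
        have hnn : (n : ℕ) ≠ 0 := fun h => hn0 (by rw [h, Nat.cast_zero])
        refine ⟨(0, n), ?_⟩
        simp only [faithfulRep, if_true, if_neg hnn]
        rw [equivalent_true_iff]
        rcases hn with hn | hn
        · rw [div_eq_iff (pow_ne_zero 2 hd0)] at hn
          refine ⟨d, (b₁ - b₂) / 2 / (n : ℕ), hd0, Or.inl ⟨?_, ?_⟩⟩
          · refine Prod.ext ?_ ?_
            · simp only [charAct]; rw [hn]; ring
            · simp only [charAct]; rw [hd]; field_simp; ring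
          · refine Prod.ext ?_ ?_
            · simp only [charAct]; rw [hn]; ring
            · simp only [charAct]; rw [hd]; field_simp; ring
        · rw [div_eq_iff (pow_ne_zero 2 hd0)] at hn
          refine ⟨d, (b₂ - b₁) / 2 / (n : ℕ), hd0, Or.inr ⟨?_, ?_⟩⟩
          · refine Prod.ext ?_ ?_
            · simp only [charAct]; rw [hn]; ring
            · simp only [charAct]; rw [hd]; field_simp; ring
          · refine Prod.ext ?_ ?_
            · simp only [charAct]; rw [hn]; ring
            · simp only [charAct]; rw [hd]; field_simp; ring
      -- `charAct` scales the determinant by `d³` and the sum `σ` by `d²`; both equal `2c` in the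
      -- normal form, hence `d = Δ / σ`.
      · set Δ := a₁ * b₂ - b₁ * a₂ with hΔ
        set σ := a₁ + a₂ with hσ'
        set d := Δ / σ with hd
        have hd0 : d ≠ 0 := div_ne_zero hdet hσ
        set c := σ / (2 * d ^ 2) with hc
        have hc0 : c ≠ 0 := div_ne_zero hσ (mul_ne_zero h2 (pow_ne_zero 2 hd0))
        obtain ⟨n, hn⟩ := exists_natCast_of_sign hp ((a₁ - a₂) / (2 * d ^ 2))
        refine ⟨(c, n), ?_⟩
        simp only [faithfulRep, if_neg hc0]
        rw [equivalent_true_iff]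
        have hcσ : 2 * d ^ 2 * c = a₁ + a₂ := by
          rw [hc, mul_div_cancel₀ _ (mul_ne_zero h2 (pow_ne_zero 2 hd0))]
        have hdσ : d * (a₁ + a₂) = a₁ * b₂ - b₁ * a₂ := by
          rw [hd, ← hσ', div_mul_cancel₀ _ hσ]
        -- The second coordinates of the normal form add up to zero, so their sum after `charAct` is
        -- `2 * c * b`.
        set b := (b₁ + b₂) / (2 * c) with hb
        have hB : 2 * c * b = b₁ + b₂ := by
          rw [hb, mul_div_cancel₀ _ (mul_ne_zero h2 hc0)]
        have h2d := mul_ne_zero h2 (pow_ne_zero 2 hd0)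
        have key : ∀ e, (a₁ - a₂) / (2 * d ^ 2) = e →
            a₁ = d ^ 2 * (c + e) ∧ b₁ = b * (c + e) - d ∧ a₂ = d ^ 2 * (c - e) ∧
              b₂ = b * (c - e) + d := by
          intro e he
          rw [div_eq_iff h2d] at he
          have h1 : a₁ = d ^ 2 * (c + e) :=
            mul_left_cancel₀ h2 (by linear_combination -hcσ + he)
          have h3 : a₂ = d ^ 2 * (c - e) :=
            mul_left_cancel₀ h2 (by linear_combination -hcσ - he)
          refine ⟨h1, mul_left_cancel₀ (mul_ne_zero h2d hc0) ?_, h3,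
            mul_left_cancel₀ (mul_ne_zero h2d hc0) ?_⟩
          · linear_combination b₁ * hcσ - d ^ 2 * (c + e) * hB + (b₁ + b₂) * h1 + d * hcσ + hdσ
          · linear_combination b₂ * hcσ - d ^ 2 * (c - e) * hB + (b₁ + b₂) * h3 - d * hcσ - hdσ
        rcases hn with hn | hn
        · obtain ⟨h1, h3, h4, h5⟩ := key _ hn
          refine ⟨d, b, hd0, Or.inl ⟨Prod.ext h1 ?_, Prod.ext h4 ?_⟩⟩
          · simp only [charAct]; linear_combination h3
          · simp only [charAct]; linear_combination h5
        · obtain ⟨h1, h3, h4, h5⟩ := key _ hn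
          -- A swap changes the sign of the determinant, hence of `d`.
          refine ⟨-d, b, neg_ne_zero.mpr hd0, Or.inr ⟨Prod.ext ?_ ?_, Prod.ext ?_ ?_⟩⟩
          · simp only [charAct]; linear_combination h1
          · simp only [charAct]; linear_combination h3
          · simp only [charAct]; linear_combination h4
          · simp only [charAct]; linear_combination h5

/-- Comparing second coordinates gives `d = 1`, or `d = -1` for a swap with `c ≠ 0`. So `d² = 1`,
and the first coordinates agree up to the order, which fixes `c` and `n` up to sign. -/
theorem faithfulRep_injective (h2 : (2 : ZMod p) ≠ 0) (hp : p % 2 = 1)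
    {x y : ZMod p × Fin ((p + 1) / 2)}
    (h : Equivalent (faithfulRep p x) (faithfulRep p y)) : x = y := by
  obtain ⟨c, n⟩ := x
  obtain ⟨c', m⟩ := y
  suffices h : c = c' ∧ ((n : ℕ) = (m : ZMod p) ∨ (n : ℕ) = -(m : ZMod p)) by
    rw [h.1, Fin.ext (natCast_inj_of_lt_half hp n.2 m.2 h.2)]
  have cancel : ∀ {a : ZMod p}, 2 * a = 0 → a = 0 := fun h => (mul_eq_zero.mp h).resolve_left h2
  simp only [faithfulRep] at h
  split_ifs at h with hc hn hc' hm hc' hm hc' hm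
  · exact ⟨hc.trans hc'.symm, Or.inl (by rw [hn, hm])⟩
  · exact absurd h.2.1 Bool.false_ne_true
  · exact absurd h.2.1 Bool.false_ne_true
  · exact absurd h.2.1.symm Bool.false_ne_true
  · rw [equivalent_true_iff] at h
    obtain ⟨d, b, hd, h⟩ := h
    simp only [charAct, Prod.mk.injEq] at h
    refine ⟨hc.trans hc'.symm, h.imp ?_ ?_⟩
    · rintro ⟨⟨h1, h3⟩, -, h4⟩
      have : d = 1 := sub_eq_zero.mp (cancel (by linear_combination -h3 - h4))
      rw [h1, this]; ring
    · rintro ⟨⟨h1, h3⟩, -, h4⟩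
      have : d = 1 := sub_eq_zero.mp (cancel (by linear_combination -h3 - h4))
      rw [h1, this]; ring
  · rw [equivalent_true_iff] at h
    obtain ⟨d, b, hd, h⟩ := h
    simp only [charAct, Prod.mk.injEq] at h
    have : d ^ 2 * c' = 0 := by
      rcases h with ⟨⟨h1, -⟩, h3, -⟩ | ⟨⟨h1, -⟩, h3, -⟩ <;>
        exact cancel (by linear_combination -h1 - h3)
    exact absurd this (mul_ne_zero (pow_ne_zero 2 hd) hc')
  · exact absurd h.2.1.symm Bool.false_ne_true
  · rw [equivalent_true_iff] at h
    obtain ⟨d, b, hd, h⟩ := h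
    simp only [charAct, Prod.mk.injEq] at h
    have : c = 0 := by
      rcases h with ⟨⟨h1, -⟩, h3, -⟩ | ⟨⟨h1, -⟩, h3, -⟩ <;>
        exact cancel (by linear_combination h1 + h3)
    exact absurd this hc
  · rw [equivalent_true_iff] at h
    obtain ⟨d, b, hd, h⟩ := h
    simp only [charAct, Prod.mk.injEq] at h
    have hb : b = 0 := by
      have : b * c' = 0 := by
        rcases h with ⟨⟨-, h1⟩, -, h3⟩ | ⟨⟨-, h1⟩, -, h3⟩ <;>
          exact cancel (by linear_combination -h1 - h3)
      exact (mul_eq_zero.mp this).resolve_right hc'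
    rcases h with ⟨⟨h1, h3⟩, h4, -⟩ | ⟨⟨h1, h3⟩, h4, -⟩
    · have hd1 : d = 1 := by rw [hb] at h3; linear_combination h3
      rw [hd1] at h1 h4
      exact ⟨sub_eq_zero.mp (cancel (by linear_combination h1 + h4)),
        Or.inl (sub_eq_zero.mp (cancel (by linear_combination h1 - h4)))⟩
    · have hd1 : d = -1 := by rw [hb] at h3; linear_combination -h3
      rw [hd1] at h1 h4
      refine ⟨sub_eq_zero.mp (cancel (by linear_combination h1 + h4)),
        Or.inr (sub_eq_zero.mp (cancel ?_))⟩
      linear_combination h1 - h4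

/-- Representatives of the braces with trivial characters. -/
def zeroRep (p : ℕ) (x : Bool × Bool) : BraceDatum p := ⟨x.1, x.2, 0, 0⟩

theorem exists_zeroRep (D : BraceDatum p) (h : MulEquivalent D (zeroDatum p)) :
    ∃ x, Equivalent D (zeroRep p x) := by
  rw [mulEquivalent_zeroDatum_iff] at h
  obtain ⟨eq, ep, χ, ψ⟩ := D
  obtain ⟨rfl, rfl⟩ := h
  exact ⟨(eq, ep), rfl, rfl, AddEquiv.refl _, fun v w => rfl, Or.inl ⟨fun w => rfl, fun w => rfl⟩⟩

end BraceDatum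

/-! ### Summing over the classes `{k, k⁻¹}` -/

/-- The number of classes `{k, k⁻¹}` in `ℤ/p` is `(p + 3) / 2`. -/
theorem two_mul_card_inverse_classes {p : ℕ} [Fact p.Prime] (h2 : (2 : ZMod p) ≠ 0) :
    2 * (Finset.univ.filter fun k : ZMod p => k.val ≤ k⁻¹.val).card = p + 3 := by
  have h1 : (Finset.univ.filter fun k : ZMod p => k⁻¹.val ≤ k.val).card =
      (Finset.univ.filter fun k : ZMod p => k.val ≤ k⁻¹.val).card :=
    Finset.card_equiv (Equiv.inv (ZMod p)) fun k => by simp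
  have h3 := Finset.card_union_add_card_inter
    (Finset.univ.filter fun k : ZMod p => k.val ≤ k⁻¹.val)
    (Finset.univ.filter fun k : ZMod p => k⁻¹.val ≤ k.val)
  rw [h1, ← two_mul] at h3
  rw [← h3]
  have h4 : (Finset.univ.filter fun k : ZMod p => k.val ≤ k⁻¹.val) ∪
      (Finset.univ.filter fun k : ZMod p => k⁻¹.val ≤ k.val) = Finset.univ := by
    ext k
    simp [le_total]
  -- The self-inverse elements, among them `0` because `0⁻¹ = 0`; that class is the action by
  -- `diag(1, u)`.
  have h5 : (Finset.univ.filter fun k : ZMod p => k.val ≤ k⁻¹.val) ∩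
      (Finset.univ.filter fun k : ZMod p => k⁻¹.val ≤ k.val) = {0, 1, -1} := by
    ext k
    simp only [Finset.mem_inter, Finset.mem_filter, Finset.mem_univ, true_and,
      Finset.mem_insert, Finset.mem_singleton, ← le_antisymm_iff]
    constructor
    · intro h
      have h6 := ZMod.val_injective p h
      by_cases hk : k = 0
      · exact Or.inl hk
      · right
        rw [← mul_self_eq_one_iff]
        nth_rewrite 2 [h6]
        exact mul_inv_cancel₀ hk
    · rintro (rfl | rfl | rfl)
      · simp
      · simp
      · rw [inv_neg, inv_one]
  have h6 : (1 : ZMod p) ≠ -1 := fun h => h2 (by linear_combination h)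
  rw [h4, h5, Finset.card_univ, ZMod.card, Finset.card_insert_of_notMem, Finset.card_pair h6]
  simp

namespace BraceDatum

variable {p : ℕ} [Fact p.Prime]

theorem MulEquivalent.symm {D D' : BraceDatum p} (h : MulEquivalent D D') :
    MulEquivalent D' D := by
  obtain ⟨g, h | h⟩ := h
  · exact ⟨g.symm, Or.inl ⟨fun w => by rw [h.1, g.apply_symm_apply],
      fun w => by rw [h.2, g.apply_symm_apply]⟩⟩
  · exact ⟨g.symm, Or.inr ⟨fun w => by rw [h.2, g.apply_symm_apply],
      fun w => by rw [h.1, g.apply_symm_apply]⟩⟩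

theorem MulEquivalent.trans {D D' D'' : BraceDatum p} (h : MulEquivalent D D')
    (h' : MulEquivalent D' D'') : MulEquivalent D D'' := by
  obtain ⟨g, h⟩ := h
  obtain ⟨g', h'⟩ := h'
  refine ⟨g.trans g', ?_⟩
  rcases h with h | h <;> rcases h' with h' | h'
  · exact Or.inl ⟨fun w => by rw [h.1, h'.1]; rfl, fun w => by rw [h.2, h'.2]; rfl⟩
  · exact Or.inr ⟨fun w => by rw [h.1, h'.1]; rfl, fun w => by rw [h.2, h'.2]; rfl⟩
  · exact Or.inr ⟨fun w => by rw [h.1, h'.2]; rfl, fun w => by rw [h.2, h'.1]; rfl⟩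
  · exact Or.inl ⟨fun w => by rw [h.1, h'.2]; rfl, fun w => by rw [h.2, h'.1]; rfl⟩

theorem Equivalent.mulEquivalent {D D' : BraceDatum p} (h : Equivalent D D') :
    MulEquivalent D D' :=
  ⟨h.2.2.choose, h.2.2.choose_spec.2.imp id And.right⟩

theorem lineDatum_mulEquivalent_iff (k k' : ZMod p) :
    MulEquivalent (lineDatum k) (lineDatum k') ↔ k = k' ∨ k * k' = 1 := by
  rw [mulEquivalent_lineDatum_iff]
  simp only [lineDatum, Prod.ext_iff, Ne, Prod.smul_mk, smul_eq_mul, mul_zero, mul_one,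
    Prod.fst_zero, Prod.snd_zero, and_true, one_ne_zero, not_false_eq_true, true_and]
  constructor
  · rintro (h | ⟨-, h⟩)
    · exact Or.inl h
    · exact Or.inr (by rw [mul_comm, h])
  · rintro (h | h)
    · exact Or.inl h
    · refine Or.inr ⟨?_, by rw [mul_comm, h]⟩
      rintro rfl
      simp at h

/-- Representatives of the classes `{k, k⁻¹}`. -/
def inverseReps (p : ℕ) [Fact p.Prime] : Finset (ZMod p) :=
  Finset.univ.filter fun k : ZMod p => k.val ≤ k⁻¹.val

theorem mem_inverseReps {k : ZMod p} : k ∈ inverseReps p ↔ k.val ≤ k⁻¹.val := by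
  simp [inverseReps]

theorem eq_of_mem_inverseReps {k k' : ZMod p} (hk : k ∈ inverseReps p) (hk' : k' ∈ inverseReps p)
    (h : k * k' = 1) : k = k' := by
  rw [mem_inverseReps] at hk hk'
  rw [inv_eq_of_mul_eq_one_right h] at hk
  rw [inv_eq_of_mul_eq_one_left h] at hk'
  exact ZMod.val_injective p (le_antisymm hk hk')

/-- The indices of all isomorphism classes. -/
abbrev TotalIndex (p : ℕ) [Fact p.Prime] : Type :=
  (Bool × Bool) ⊕ (Σ k : {k // k ∈ inverseReps p}, {x // LineIndex (p := p) k x}) ⊕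
    (ZMod p × Fin ((p + 1) / 2))

/-- Representatives of all isomorphism classes. -/
def totalRep (n : ZMod p) : TotalIndex p → BraceDatum p
  | Sum.inl x => zeroRep p x
  | Sum.inr (Sum.inl x) => lineRep n x.1 x.2
  | Sum.inr (Sum.inr x) => faithfulRep p x

theorem zeroRep_valid (p : ℕ) (x : Bool × Bool) : (zeroRep p x).Valid := fun _ => (add_zero _).symm

theorem totalRep_valid (n : ZMod p) (x : TotalIndex p) : (totalRep n x).Valid := by
  rcases x with x | x | x
  · exact zeroRep_valid p x
  · exact lineRep_valid _ _ _
  · exact faithfulRep_valid _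

theorem zeroRep_mulEquivalent (x : Bool × Bool) : MulEquivalent (zeroRep p x) (zeroDatum p) :=
  (mulEquivalent_zeroDatum_iff _).mpr ⟨rfl, rfl⟩

theorem zeroRep_injective {x y : Bool × Bool} (h : Equivalent (zeroRep p x) (zeroRep p y)) :
    x = y := Prod.ext h.1 h.2.1

theorem exists_totalRep (h2 : (2 : ZMod p) ≠ 0) (hp : p % 2 = 1) {n : ZMod p}
    (hn : ¬ IsSquare n) (D : BraceDatum p) (hD : D.Valid) : ∃ x, Equivalent D (totalRep n x) := by
  rcases mulEquivalent_cases D with h | ⟨k, h⟩ | h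
  · obtain ⟨x, hx⟩ := exists_zeroRep D h
    exact ⟨Sum.inl x, hx⟩
  · obtain ⟨k', hk', h'⟩ : ∃ k' ∈ inverseReps p, MulEquivalent D (lineDatum k') := by
      by_cases hk : k ∈ inverseReps p
      · exact ⟨k, hk, h⟩
      · refine ⟨k⁻¹, ?_, h.trans ((lineDatum_mulEquivalent_iff _ _).mpr (Or.inr ?_))⟩
        · rw [mem_inverseReps] at hk ⊢
          rw [inv_inv]
          exact (not_le.mp hk).le
        · refine mul_inv_cancel₀ ?_
          rintro rfl
          exact hk (mem_inverseReps.mpr (by simp))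
    obtain ⟨x, hx, hDx⟩ := exists_lineRep hn k' D hD h'
    exact ⟨Sum.inr (Sum.inl ⟨⟨k', hk'⟩, ⟨x, hx⟩⟩), hDx⟩
  · obtain ⟨x, hx⟩ := exists_faithfulRep h2 hp D hD h
    exact ⟨Sum.inr (Sum.inr x), hx⟩

theorem not_zero_line (k : ZMod p) : ¬ MulEquivalent (lineDatum k) (zeroDatum p) := by
  rw [mulEquivalent_zeroDatum_iff]
  simp [lineDatum]

theorem not_line_faithful (k : ZMod p) : ¬ MulEquivalent (lineDatum k) (faithfulDatum p) := by
  rw [mulEquivalent_faithfulDatum_iff]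
  simp [lineDatum]

theorem not_zero_faithful : ¬ MulEquivalent (zeroDatum p) (faithfulDatum p) := by
  rw [mulEquivalent_faithfulDatum_iff]
  simp [zeroDatum]

theorem totalRep_injective (h2 : (2 : ZMod p) ≠ 0) (hp : p % 2 = 1) {n : ZMod p}
    (hn : ¬ IsSquare n) (x y : TotalIndex p) (h : Equivalent (totalRep n x) (totalRep n y)) :
    x = y := by
  have hm := h.mulEquivalent
  rcases x with x | ⟨⟨k, hk⟩, ⟨x, hx⟩⟩ | x <;> rcases y with y | ⟨⟨k', hk'⟩, ⟨y, hy⟩⟩ | y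
  · rw [zeroRep_injective h]
  · exact absurd ((lineRep_mulEquivalent h2 hn k' y hy).symm.trans
      (hm.symm.trans (zeroRep_mulEquivalent x))) (not_zero_line k')
  · exact absurd ((zeroRep_mulEquivalent x).symm.trans
      (hm.trans (faithfulRep_mulEquivalent h2 y))) not_zero_faithful
  · exact absurd ((lineRep_mulEquivalent h2 hn k x hx).symm.trans
      (hm.trans (zeroRep_mulEquivalent y))) (not_zero_line k)
  · have hkk := (lineDatum_mulEquivalent_iff _ _).mp ((lineRep_mulEquivalent h2 hn k x hx).symm.trans
      (hm.trans (lineRep_mulEquivalent h2 hn k' y hy)))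
    obtain rfl : k = k' := hkk.elim id (eq_of_mem_inverseReps hk hk')
    obtain rfl := lineRep_injective hn (by omega) k hx hy h
    rfl
  · exact absurd ((lineRep_mulEquivalent h2 hn k x hx).symm.trans
      (hm.trans (faithfulRep_mulEquivalent h2 y))) (not_line_faithful k)
  · exact absurd ((zeroRep_mulEquivalent y).symm.trans
      (hm.symm.trans (faithfulRep_mulEquivalent h2 x))) not_zero_faithful
  · exact absurd ((lineRep_mulEquivalent h2 hn k' y hy).symm.trans
      (hm.symm.trans (faithfulRep_mulEquivalent h2 x))) (not_line_faithful k')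
  · rw [faithfulRep_injective h2 hp h]

-- The sum is `4 + 4 (p + 3) / 2 + 4 + p (p + 1) / 2`, less one if `p ≡ 3` modulo `4`.
open Classical in
theorem card_totalIndex (h2 : (2 : ZMod p) ≠ 0) (hp : p % 2 = 1) :
    Fintype.card (TotalIndex p) + (if p % 4 = 3 then 1 else 0) = (p ^ 2 + 5 * p) / 2 + 14 := by
  have h3 : 2 * (inverseReps p).card = p + 3 := two_mul_card_inverse_classes h2
  have hneg : (-1 : ZMod p) ∈ inverseReps p := by
    rw [mem_inverseReps, inv_neg, inv_one]
  have hsum1 : ∑ k ∈ inverseReps p, (if k = -1 ∧ p % 4 = 3 then 3 else 4) +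
      (if p % 4 = 3 then 1 else 0) = (inverseReps p).card * 4 := by
    by_cases h : p % 4 = 3
    · simp only [h, and_true, if_true]
      have : ∑ k ∈ inverseReps p, (if k = -1 then 1 else 0) = 1 := by
        rw [Finset.sum_ite_eq', if_pos hneg]
      rw [← this, ← Finset.sum_add_distrib, ← smul_eq_mul, ← Finset.sum_const]
      refine Finset.sum_congr rfl fun k _ => ?_
      split_ifs <;> rfl
    · simp [h]
  -- The elements `2` and `1/2` form one class, also for `p = 3`, where they coincide.
  have hsum2 : ∑ k ∈ inverseReps p, (if k = 2 ∨ 2 * k = 1 then 4 else 0) = 4 := by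
    obtain ⟨k₀, hk₀, hk⟩ : ∃ k₀ ∈ inverseReps p, ∀ k ∈ inverseReps p,
        (k = 2 ∨ 2 * k = 1) ↔ k = k₀ := by
      have h22 : (2 : ZMod p) * 2⁻¹ = 1 := mul_inv_cancel₀ h2
      have hinv : ∀ k : ZMod p, 2 * k = 1 ↔ k = 2⁻¹ := fun k =>
        ⟨fun h => (inv_eq_of_mul_eq_one_right h).symm, fun h => by rw [h, h22]⟩
      simp only [hinv]
      by_cases hm : (2 : ZMod p) ∈ inverseReps p
      · refine ⟨2, hm, fun k hk => ⟨?_, Or.inl⟩⟩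
        rintro (rfl | rfl)
        · rfl
        · exact (eq_of_mem_inverseReps hm hk h22).symm
      · have hm' : (2⁻¹ : ZMod p) ∈ inverseReps p := by
          rw [mem_inverseReps] at hm ⊢
          rw [inv_inv]
          exact (not_le.mp hm).le
        refine ⟨2⁻¹, hm', fun k hk => ⟨?_, Or.inr⟩⟩
        rintro (rfl | rfl)
        · exact absurd hk hm
        · rfl
    rw [Finset.sum_congr rfl fun k hk' => if_congr (hk k hk') rfl rfl, Finset.sum_ite_eq',
      if_pos hk₀]
  have hcard : Fintype.card (TotalIndex p) = 4 + (∑ k ∈ inverseReps p,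
      ((if k = -1 ∧ p % 4 = 3 then 3 else 4) + (if k = 2 ∨ 2 * k = 1 then 4 else 0)) +
      p * ((p + 1) / 2)) := by
    rw [Fintype.card_sum, Fintype.card_sum, Fintype.card_sigma, Fintype.card_prod (ZMod p),
      ZMod.card, Fintype.card_fin, ← Finset.sum_coe_sort (inverseReps p)]
    congr 2
    exact Finset.sum_congr rfl fun k _ => card_lineIndex _
  rw [hcard, Finset.sum_add_distrib, hsum2]
  obtain ⟨m, hm⟩ : ∃ m, p = 2 * m + 1 := ⟨p / 2, by omega⟩
  have e1 : p * ((p + 1) / 2) = (2 * m + 1) * (m + 1) := by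
    rw [show (p + 1) / 2 = m + 1 by omega, hm]
  have e2 : (p ^ 2 + 5 * p) / 2 = (2 * m + 1) * (m + 3) := by
    rw [show p ^ 2 + 5 * p = 2 * ((2 * m + 1) * (m + 3)) by rw [hm]; ring]
    simp
  have e3 : (2 * m + 1) * (m + 3) = (2 * m + 1) * (m + 1) + 2 * (2 * m + 1) := by ring
  rw [e1, e2, e3]
  omega

end BraceDatum

/-! ### From parameters to isomorphism classes of braces -/

section Count

variable {p q : ℕ} [Fact p.Prime] [Fact q.Prime] {u : (ZMod q)ˣ} (hu : u ^ p = 1)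

namespace BraceDatum

theorem exists_addEquiv_zmod_mul (hpq : p < q) :
    Nonempty ((ZMod q × ZMod q) × (ZMod p × ZMod p) ≃+ ZMod (p * q) × ZMod (p * q)) := by
  have hcop : p.Coprime q := (Nat.coprime_primes Fact.out Fact.out).mpr hpq.ne
  let e := (ZMod.chineseRemainder hcop).toAddEquiv
  exact ⟨((AddEquiv.prodCongr e e).trans ((AddEquiv.prodProdProdComm _ _ _ _).trans
    AddEquiv.prodComm)).symm⟩

/-- The brace with parameters `D`. -/
def brace (h2 : (2 : ZMod p) ≠ 0) (D : BraceDatum p) (hD : D.Valid) : BundledLeftBrace :=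
  (D.isGamma u hu h2 hD).brace

theorem brace_hasAddGroup (h2 : (2 : ZMod p) ≠ 0) (hpq : p < q) (D : BraceDatum p)
    (hD : D.Valid) : (D.brace hu h2 hD).HasAddGroup (ZMod (p * q) × ZMod (p * q)) :=
  IsGamma.hasAddGroup _ (exists_addEquiv_zmod_mul hpq).some

theorem brace_equiv_iff (h2 : (2 : ZMod p) ≠ 0) (hpq : p < q) (hu1 : u ≠ 1) (D D' : BraceDatum p)
    (hD : D.Valid) (hD' : D'.Valid) :
    D.brace hu h2 hD ≈ D'.brace hu h2 hD' ↔ Equivalent D D' :=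
  (IsGamma.brace_equiv_iff _ _).trans (exists_gamma_equiv_iff hu hpq hu1 D D')

theorem exists_brace_equiv (h2 : (2 : ZMod p) ≠ 0) (hpq : p < q) (hq : ¬ q ∣ p ^ 2 - 1)
    (hu1 : u ≠ 1) (B : BundledLeftBrace) (hB : B.HasAddGroup (ZMod (p * q) × ZMod (p * q))) :
    ∃ (D : BraceDatum p) (hD : D.Valid), B ≈ D.brace hu h2 hD := by
  obtain ⟨e⟩ := hB
  obtain ⟨lam, h, hB⟩ := B.exists_gamma ⟨e.trans (exists_addEquiv_zmod_mul hpq).some.symm⟩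
  obtain ⟨D, hD, f, hf⟩ := h.exists_datum hu h2 hpq hq hu1
  exact ⟨D, hD, Setoid.trans hB ((IsGamma.brace_equiv_iff _ _).mpr ⟨f, hf⟩)⟩

/-- `G` is the multiplicative group of the brace with the characters of `T`. -/
def IsMulGroup (T : BraceDatum p) (G : Type) [Group G] : Prop :=
  ∃ f : (ZMod q × ZMod q) × (ZMod p × ZMod p) ≃ G,
    ∀ a b, f (a + T.trivialize.gamma u hu a b) = f a * f b

/-- Straightening both factors reduces the multiplicative group to that of the trivialised datum,
where group isomorphism is `MulEquivalent`. -/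
theorem IsMulGroup.brace_hasMulGroup_iff (h2 : (2 : ZMod p) ≠ 0) (h2q : (2 : ZMod q) ≠ 0)
    (hpq : p < q) (hu1 : u ≠ 1) {T : BraceDatum p} {G : Type} [Group G] (hG : IsMulGroup hu T G)
    (D : BraceDatum p) (hD : D.Valid) :
    (D.brace hu h2 hD).HasMulGroup G ↔ MulEquivalent D T := by
  obtain ⟨φ, hφ⟩ := hG
  obtain ⟨t, ht⟩ := exists_mul_equiv_trivialize hu h2 h2q hD
  rw [brace, IsGamma.hasMulGroup_iff]
  constructor
  · rintro ⟨f, hf⟩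
    refine mulEquivalent_of_equiv hu hpq hu1 (t.symm.trans (f.trans φ.symm)) fun a b => ?_
    obtain ⟨a, rfl⟩ := t.surjective a
    obtain ⟨b, rfl⟩ := t.surjective b
    rw [← ht]
    simp only [Equiv.trans_apply, Equiv.symm_apply_apply]
    rw [Equiv.symm_apply_eq, hφ, Equiv.apply_symm_apply, Equiv.apply_symm_apply, hf]
  · intro h
    obtain ⟨f, hf⟩ := (exists_gamma_equiv_iff hu hpq hu1 _ _).mpr h.trivialize_equivalent
    refine ⟨t.trans (f.toEquiv.trans φ), fun a b => ?_⟩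
    change φ (f (t _)) = φ (f (t a)) * φ (f (t b))
    rw [ht, map_add, hf, hφ]

theorem ncard_classes (h2 : (2 : ZMod p) ≠ 0) (hpq : p < q) (hu1 : u ≠ 1)
    (S : Set BundledLeftBrace) (P : BraceDatum p → Prop)
    (hS : ∀ D hD, D.brace hu h2 hD ∈ S ↔ P D)
    (hS' : ∀ B ∈ S, ∃ (D : BraceDatum p) (hD : D.Valid), P D ∧ B ≈ D.brace hu h2 hD)
    {ι : Type*} [Fintype ι] (rep : ι → BraceDatum p) (hval : ∀ i, (rep i).Valid)
    (hP : ∀ i, P (rep i)) (hex : ∀ D : BraceDatum p, D.Valid → P D → ∃ i, Equivalent D (rep i))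
    (hinj : ∀ i j, Equivalent (rep i) (rep j) → i = j) :
    Set.ncard ((fun B => (⟦B⟧ : Quotient BundledLeftBrace.isoSetoid)) '' S) = Fintype.card ι := by
  refine BundledLeftBrace.ncard_classes S (fun i => (rep i).brace hu h2 (hval i))
    (fun i => (hS _ _).mpr (hP i)) (fun B hB => ?_)
    fun i j h => hinj i j ((brace_equiv_iff hu h2 hpq hu1 _ _ _ _).mp h)
  obtain ⟨D, hD, hPD, hBD⟩ := hS' B hB
  obtain ⟨i, hi⟩ := hex D hD hPD
  exact ⟨i, Setoid.trans hBD ((brace_equiv_iff hu h2 hpq hu1 _ _ _ _).mpr hi)⟩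

theorem IsMulGroup.numBracesWithMul_eq (h2 : (2 : ZMod p) ≠ 0) (h2q : (2 : ZMod q) ≠ 0)
    (hpq : p < q) (hq : ¬ q ∣ p ^ 2 - 1) (hu1 : u ≠ 1) {T : BraceDatum p} {G : Type} [Group G]
    (hG : IsMulGroup hu T G) {ι : Type*} [Fintype ι] (rep : ι → BraceDatum p)
    (hval : ∀ i, (rep i).Valid) (hP : ∀ i, MulEquivalent (rep i) T)
    (hex : ∀ D : BraceDatum p, D.Valid → MulEquivalent D T → ∃ i, Equivalent D (rep i))
    (hinj : ∀ i j, Equivalent (rep i) (rep j) → i = j) :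
    BundledLeftBrace.numBracesWithMul (ZMod (p * q) × ZMod (p * q)) G = Fintype.card ι := by
  refine ncard_classes hu h2 hpq hu1 _ (fun D => MulEquivalent D T) (fun D hD => ?_)
    (fun B hB => ?_) rep hval hP hex hinj
  · rw [← hG.brace_hasMulGroup_iff hu h2 h2q hpq hu1 D hD]
    exact ⟨fun h => h.2, fun h => ⟨brace_hasAddGroup hu h2 hpq D hD, h⟩⟩
  · obtain ⟨D, hD, hBD⟩ := exists_brace_equiv hu h2 hpq hq hu1 B hB.1
    exact ⟨D, hD, (hG.brace_hasMulGroup_iff hu h2 h2q hpq hu1 D hD).mp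
      (BundledLeftBrace.HasMulGroup.congr (Setoid.symm hBD) hB.2), hBD⟩

theorem isMulGroup_zero (hpq : p < q) : IsMulGroup hu (zeroDatum p)
    (Multiplicative (ZMod (p * q) × ZMod (p * q))) := by
  obtain ⟨e⟩ := exists_addEquiv_zmod_mul (p := p) hpq
  refine ⟨e.toEquiv.trans Multiplicative.ofAdd, ?_⟩
  rintro ⟨v, w⟩ ⟨x, y⟩
  have : (zeroDatum p).trivialize.gamma u hu (v, w) (x, y) = (x, y) := by
    simp [gamma_apply, trivialize, zeroDatum, shear_apply, diag, diagEquiv_apply, planePair,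
      unitChar_zero]
  rw [this]
  change Multiplicative.ofAdd (e _) = _
  rw [map_add]
  rfl

theorem isMulGroup_diag (i j : ℤ) : IsMulGroup hu (⟨false, false, (i, 0), (j, 0)⟩ : BraceDatum p)
    (SemidirectByDiag p q u hu i j) := by
  refine exists_equiv_semidirectProduct _ _ fun w => ?_
  change diagGL (u ^ i) (u ^ j) ^ w.toAdd.1.val = _
  have key : ∀ i : ℤ, (u ^ i) ^ w.toAdd.1.val = unitChar u hu (planePair ((i : ZMod p), 0) w.toAdd) := by
    intro i
    rw [← zpow_natCast, ← zpow_mul, ← unitChar_intCast u hu]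
    simp [planePair]
  rw [diagGL_pow, key, key]

theorem isMulGroup_faithful :
    IsMulGroup hu (faithfulDatum p) (SemidirectFaithful p q u hu) := by
  refine exists_equiv_semidirectProduct _ _ fun w => ?_
  change diagGL (unitChar u hu w.toAdd.2) (unitChar u hu (w.toAdd.1 + w.toAdd.2)) = _
  simp [faithfulDatum, planePair]

theorem IsMulGroup.congr {T T' : BraceDatum p} {G : Type} [Group G] (hpq : p < q) (hu1 : u ≠ 1)
    (hG : IsMulGroup hu T G) (h : MulEquivalent T' T) : IsMulGroup hu T' G := by
  obtain ⟨φ, hφ⟩ := hG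
  obtain ⟨f, hf⟩ := (exists_gamma_equiv_iff hu hpq hu1 _ _).mpr h.trivialize_equivalent
  exact ⟨f.toEquiv.trans φ, fun a b => by
    change φ (f _) = φ (f a) * φ (f b)
    rw [map_add, hf, hφ]⟩

theorem isMulGroup_zero_one (hpq : p < q) (hu1 : u ≠ 1) :
    IsMulGroup hu (lineDatum (0 : ZMod p)) (SemidirectByDiag p q u hu 0 1) := by
  refine (isMulGroup_diag hu 0 1).congr hu hpq hu1 ⟨AddEquiv.refl _, Or.inr ⟨fun w => ?_,
    fun w => ?_⟩⟩ <;> simp [lineDatum]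

theorem isMulGroup_one (j : ℤ) :
    IsMulGroup hu (lineDatum (j : ZMod p)) (SemidirectByDiag p q u hu 1 j) := by
  have := isMulGroup_diag (p := p) hu 1 j
  rwa [Int.cast_one] at this

open Classical in
theorem IsMulGroup.numBracesWithMul_line (h2 : (2 : ZMod p) ≠ 0) (h2q : (2 : ZMod q) ≠ 0)
    (hp : p % 2 = 1)
    (hpq : p < q) (hq : ¬ q ∣ p ^ 2 - 1) (hu1 : u ≠ 1) {k : ZMod p} {G : Type} [Group G]
    (hG : IsMulGroup hu (lineDatum k) G) :
    BundledLeftBrace.numBracesWithMul (ZMod (p * q) × ZMod (p * q)) G =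
      (if k = -1 ∧ p % 4 = 3 then 3 else 4) + (if k = 2 ∨ 2 * k = 1 then 4 else 0) := by
  obtain ⟨n, hn⟩ := exists_nonsquare h2
  rw [← card_lineIndex, hG.numBracesWithMul_eq hu h2 h2q hpq hq hu1
    (fun x : {x // LineIndex k x} => lineRep n k x) (fun x => lineRep_valid _ _ _)
    (fun x => lineRep_mulEquivalent h2 hn k x x.2) (fun D hD h => ?_)
    (fun x y h => Subtype.ext (lineRep_injective hn (by omega) k x.2 y.2 h))]
  obtain ⟨x, hx, h⟩ := exists_lineRep hn k D hD h
  exact ⟨⟨x, hx⟩, h⟩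

theorem numBraces_eq (hu : u ^ p = 1) (h2 : (2 : ZMod p) ≠ 0) (hp : p % 2 = 1) (hpq : p < q)
    (hq : ¬ q ∣ p ^ 2 - 1) (hu1 : u ≠ 1) :
    BundledLeftBrace.numBraces (ZMod (p * q) × ZMod (p * q)) + (if p % 4 = 3 then 1 else 0) =
      (p ^ 2 + 5 * p) / 2 + 14 := by
  classical
  obtain ⟨n, hn⟩ := exists_nonsquare h2
  rw [← card_totalIndex h2 hp]
  congr 1
  refine ncard_classes hu h2 hpq hu1 _ (fun _ => True)
    (fun D hD => ⟨fun _ => trivial, fun _ => brace_hasAddGroup hu h2 hpq D hD⟩) (fun B hB => ?_)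
    (totalRep n) (totalRep_valid n) (fun _ => trivial)
    (fun D hD _ => exists_totalRep h2 hp hn D hD) (totalRep_injective h2 hp hn)
  obtain ⟨D, hD, h⟩ := exists_brace_equiv hu h2 hpq hq hu1 B hB
  exact ⟨D, hD, trivial, h⟩

end BraceDatum

end Count

/-! ### Arithmetic of `p` and `q`, and the theorem -/

/-- A prime `q > p` dividing `(p + 1) (p - 1)` must be `p + 1`, which is even and exceeds `2`. -/
theorem not_dvd_sq_sub_one {p q : ℕ} (hp : p.Prime) (hq : q.Prime) (hpq : p < q) (hodd : p % 2 = 1)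
    (hq5 : 5 ≤ q) : ¬ q ∣ p ^ 2 - 1 := by
  rw [show p ^ 2 - 1 = (p + 1) * (p - 1) by rw [← Nat.sq_sub_sq], hq.dvd_mul]
  have := hp.two_le
  rintro (h | h)
  · have h1 := Nat.le_of_dvd (by omega) h
    rcases hq.eq_two_or_odd with h2 | h2 <;> omega
  · have h1 := Nat.le_of_dvd (by omega) h
    omega

theorem exists_unit_of_prime_order {p q : ℕ} [Fact p.Prime] [Fact q.Prime] (h : p ∣ q - 1) :
    ∃ u : (ZMod q)ˣ, u ^ p = 1 ∧ u ≠ 1 := by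
  obtain ⟨u, hu⟩ := exists_prime_orderOf_dvd_card' (G := (ZMod q)ˣ) p
    (by rw [Nat.card_eq_fintype_card, ZMod.card_units]; exact h)
  refine ⟨u, by rw [← hu, pow_orderOf_eq_one], ?_⟩
  rintro rfl
  rw [orderOf_one] at hu
  exact (Fact.out : p.Prime).ne_one hu.symm

theorem ZMod.natCast_eq_natCast_of_lt {p k m : ℕ} (hk : k < p) (hm : m < p)
    (h : (k : ZMod p) = m) : k = m := by
  rwa [ZMod.natCast_eq_natCast_iff', Nat.mod_eq_of_lt hk, Nat.mod_eq_of_lt hm] at h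

theorem mainTheorem6 (p q : ℕ) [Fact p.Prime] [Fact q.Prime]
    (hpq : p < q) (hq5 : 5 ≤ q) (hp_dvd : p ∣ q - 1) (hp_ndvd : ¬ p ∣ q + 1)
    (hp2_ndvd : ¬ p ^ 2 ∣ q - 1) :
    -- the total number of braces
    (p % 4 = 1 → BundledLeftBrace.numBraces (ZMod (p * q) × ZMod (p * q)) =
      (p ^ 2 + 5 * p) / 2 + 14) ∧
    (p % 4 = 3 → BundledLeftBrace.numBraces (ZMod (p * q) × ZMod (p * q)) =
      (p ^ 2 + 5 * p) / 2 + 13) ∧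
    -- the abelian multiplicative group
    BundledLeftBrace.numBracesWithMul (ZMod (p * q) × ZMod (p * q))
      (Multiplicative (ZMod (p * q) × ZMod (p * q))) = 4 ∧
    -- the other multiplicative groups, for any choice of an element `u` of order `p`
    ∀ (u : (ZMod q)ˣ) (hu : u ^ p = 1), u ≠ 1 →
      -- `M = diag(1, u)`, and `M = diag(u, u ^ k)` for the unexceptional `k`
      BundledLeftBrace.numBracesWithMul (ZMod (p * q) × ZMod (p * q))
        (SemidirectByDiag p q u hu 0 1) = 4 ∧
      (∀ k : ℕ, 1 ≤ k → k ≤ p - 1 → k ≠ p - 1 → k ≠ (p + 1) / 2 → k ≠ 2 →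
        BundledLeftBrace.numBracesWithMul (ZMod (p * q) × ZMod (p * q))
          (SemidirectByDiag p q u hu 1 k) = 4) ∧
      -- `M = diag(u, u⁻¹)`
      (p ≠ 3 → p % 4 = 1 →
        BundledLeftBrace.numBracesWithMul (ZMod (p * q) × ZMod (p * q))
          (SemidirectByDiag p q u hu 1 (-1)) = 4) ∧
      (p ≠ 3 → p % 4 = 3 →
        BundledLeftBrace.numBracesWithMul (ZMod (p * q) × ZMod (p * q))
          (SemidirectByDiag p q u hu 1 (-1)) = 3) ∧
      -- `M = diag(u, u ^ ((p + 1) / 2))`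
      (p ≠ 3 →
        BundledLeftBrace.numBracesWithMul (ZMod (p * q) × ZMod (p * q))
          (SemidirectByDiag p q u hu 1 (((p + 1) / 2 : ℕ) : ℤ)) = 8) ∧
      -- for `p = 3` the matrices of the last two cases coincide
      (p = 3 →
        BundledLeftBrace.numBracesWithMul (ZMod (p * q) × ZMod (p * q))
          (SemidirectByDiag p q u hu 1 (-1)) = 7) ∧
      -- the faithful action
      BundledLeftBrace.numBracesWithMul (ZMod (p * q) × ZMod (p * q))
        (SemidirectFaithful p q u hu) = (p ^ 2 + p) / 2 ∧
      -- there are no other multiplicative groups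
      (∀ B : BundledLeftBrace, B.HasAddGroup (ZMod (p * q) × ZMod (p * q)) →
        B.HasMulGroup (Multiplicative (ZMod (p * q) × ZMod (p * q))) ∨
        B.HasMulGroup (SemidirectByDiag p q u hu 0 1) ∨
        (∃ k : ℕ, 1 ≤ k ∧ k ≤ p - 1 ∧ B.HasMulGroup (SemidirectByDiag p q u hu 1 k)) ∨
        B.HasMulGroup (SemidirectFaithful p q u hu)) := by
  have hp : p.Prime := Fact.out
  have hq' : q.Prime := Fact.out
  -- For `p = 2` the odd prime `q` would satisfy `p ∣ q + 1`.
  have hp2 : p ≠ 2 := by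
    rintro rfl
    rcases hq'.eq_two_or_odd with h | h <;> omega
  have hodd : p % 2 = 1 := hp.eq_two_or_odd.resolve_left hp2
  have hp3 : 3 ≤ p := by have := hp.two_le; omega
  have two_ne : ∀ m : ℕ, 2 < m → (2 : ZMod m) ≠ 0 := fun m hm h => by
    have := ZMod.natCast_eq_natCast_of_lt hm (by omega : 0 < m) (by exact_mod_cast h)
    omega
  have h2 := two_ne p (by omega)
  have h2q := two_ne q (by omega)
  have hq := not_dvd_sq_sub_one hp hq' hpq hodd hq5
  -- The total and the abelian case do not mention `u`, but the models need some element of order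
  -- `p`.
  obtain ⟨u₀, hu₀, hu₀1⟩ := exists_unit_of_prime_order (p := p) hp_dvd
  have htotal := BraceDatum.numBraces_eq hu₀ h2 hodd hpq hq hu₀1
  have hhalf : (2 : ZMod p) * ((p + 1) / 2 : ℕ) = 1 := by
    have := congrArg (Nat.cast (R := ZMod p)) (show 2 * ((p + 1) / 2) = p + 1 by omega)
    rwa [Nat.cast_mul, Nat.cast_add, ZMod.natCast_self, zero_add, Nat.cast_one,
      Nat.cast_ofNat] at this
  -- The exceptional ratio `-1` meets `2` or `1/2` only if `3 = 0` in `ℤ/p`.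
  have hneg : p ≠ 3 → ¬ ((-1 : ZMod p) = 2 ∨ 2 * (-1 : ZMod p) = 1) := by
    intro hp3' hcon
    have h3 : ((3 : ℕ) : ZMod p) = ((0 : ℕ) : ZMod p) := by
      push_cast
      rcases hcon with h | h <;> linear_combination -h
    have := ZMod.natCast_eq_natCast_of_lt (by omega) (by omega) h3
    omega
  refine ⟨fun h => ?_, fun h => ?_, ?_, fun u hu hu1 => ⟨?_, ?_, ?_, ?_, ?_, ?_, ?_, ?_⟩⟩
  · rw [if_neg (by omega)] at htotal
    exact htotal
  · rw [if_pos h] at htotal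
    omega
  · exact (BraceDatum.isMulGroup_zero hu₀ hpq).numBracesWithMul_eq hu₀ h2 h2q hpq hq hu₀1
      (BraceDatum.zeroRep p) (BraceDatum.zeroRep_valid p) BraceDatum.zeroRep_mulEquivalent
      (fun D _ h => BraceDatum.exists_zeroRep D h) fun _ _ h => BraceDatum.zeroRep_injective h
  · rw [(BraceDatum.isMulGroup_zero_one hu hpq hu1).numBracesWithMul_line hu h2 h2q hodd hpq hq hu1,
      if_neg, if_neg]
    · rintro (h | h)
      · exact h2 h.symm
      · simp at h
    · rintro ⟨h, -⟩
      simp at h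
  · intro k hk1 hk2 hk3 hk4 hk5
    have hkcast : ((k : ℤ) : ZMod p) = (k : ZMod p) := Int.cast_natCast k
    rw [(BraceDatum.isMulGroup_one hu k).numBracesWithMul_line hu h2 h2q hodd hpq hq hu1,
      if_neg, if_neg]
    · rw [hkcast]
      rintro (h | h)
      · exact hk5 (ZMod.natCast_eq_natCast_of_lt (p := p) (k := k) (m := 2) (by omega) (by omega) (by exact_mod_cast h))
      · have h5 : (k : ZMod p) = ((p + 1) / 2 : ℕ) := mul_left_cancel₀ h2 (h.trans hhalf.symm)
        exact hk4 (ZMod.natCast_eq_natCast_of_lt (by omega) (by omega) h5)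
    · rw [hkcast]
      rintro ⟨h, -⟩
      refine hk3 (ZMod.natCast_eq_natCast_of_lt (p := p) (k := k) (m := p - 1) (by omega) (by omega) ?_)
      rw [h, Nat.cast_sub (by omega), CharP.cast_eq_zero]
      simp
  · intro hp3' h4
    rw [(BraceDatum.isMulGroup_one hu (-1)).numBracesWithMul_line hu h2 h2q hodd hpq hq hu1,
      Int.cast_neg, Int.cast_one, if_neg (by omega), if_neg (hneg hp3')]
  · intro hp3' h4
    rw [(BraceDatum.isMulGroup_one hu (-1)).numBracesWithMul_line hu h2 h2q hodd hpq hq hu1,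
      Int.cast_neg, Int.cast_one, if_pos ⟨rfl, h4⟩, if_neg (hneg hp3')]
  · intro hp3'
    rw [(BraceDatum.isMulGroup_one hu _).numBracesWithMul_line hu h2 h2q hodd hpq hq hu1,
      Int.cast_natCast, if_neg, if_pos (Or.inr hhalf)]
    rintro ⟨h, -⟩
    rw [h] at hhalf
    exact hneg hp3' (Or.inr hhalf)
  · rintro rfl
    rw [(BraceDatum.isMulGroup_one hu (-1)).numBracesWithMul_line hu h2 h2q hodd hpq hq hu1,
      Int.cast_neg, Int.cast_one, if_pos ⟨rfl, rfl⟩, if_pos]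
    left
    have h3 : ((3 : ℕ) : ZMod 3) = 0 := ZMod.natCast_self 3
    push_cast at h3
    linear_combination -h3
  · rw [(BraceDatum.isMulGroup_faithful hu).numBracesWithMul_eq hu h2 h2q hpq hq hu1
      (BraceDatum.faithfulRep p) BraceDatum.faithfulRep_valid
      (BraceDatum.faithfulRep_mulEquivalent h2)
      (fun D hD h => BraceDatum.exists_faithfulRep h2 hodd D hD h)
      (fun _ _ h => BraceDatum.faithfulRep_injective h2 hodd h),
      Fintype.card_prod, ZMod.card, Fintype.card_fin]
    obtain ⟨m, hm⟩ : ∃ m, p + 1 = 2 * m := ⟨(p + 1) / 2, by omega⟩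
    rw [show p ^ 2 + p = p * (p + 1) by ring, hm, mul_left_comm]
    simp
  · intro B hB
    obtain ⟨D, hD, hBD⟩ := BraceDatum.exists_brace_equiv hu h2 hpq hq hu1 B hB
    have transfer : ∀ {T : BraceDatum p} {G : Type} [Group G], BraceDatum.IsMulGroup hu T G →
        BraceDatum.MulEquivalent D T → B.HasMulGroup G := fun hG h =>
      BundledLeftBrace.HasMulGroup.congr hBD
        ((hG.brace_hasMulGroup_iff hu h2 h2q hpq hu1 D hD).mpr h)
    rcases BraceDatum.mulEquivalent_cases D with h | ⟨k, h⟩ | h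
    · exact Or.inl (transfer (BraceDatum.isMulGroup_zero hu hpq) h)
    · by_cases hk : k = 0
      · subst hk
        exact Or.inr (Or.inl (transfer (BraceDatum.isMulGroup_zero_one hu hpq hu1) h))
      · refine Or.inr (Or.inr (Or.inl ⟨k.val, ?_, ?_, transfer
          (BraceDatum.isMulGroup_one hu k.val) ?_⟩))
        · exact Nat.one_le_iff_ne_zero.mpr ((ZMod.val_ne_zero k).mpr hk)
        · have := k.val_lt
          omega
        · rw [Int.cast_natCast, ZMod.natCast_zmod_val]
          exact h
    · exact Or.inr (Or.inr (Or.inr (transfer (BraceDatum.isMulGroup_faithful hu) h)))
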